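/- Let $(M,g)$ be a smooth Lorentzian manifold of dimension $d$ (Hausdorff, second countable, signature $(-,+,\dots,+)$), let $E\to M$ be a smooth complex vector bundle of finite rank, and let $P:\Gamma(E)\to\Gamma(E)$ be a normally hyperbolic operator, i.e. a $\mathbb C$-linear second order differential operator whose principal symbol at a covector $\xi$ is $-g(\xi,\xi)\,\mathrm{id}_E$. Let $\nabla$ be the connection on $E$ induced by $P$, i.e. the smooth connection with $P(fs)=fPs-2\nabla_{\operatorname{grad}f}s+(\square f)s$ for all $f\in C^\infty(M,\mathbb R)$ and $s\in\Gamma(E)$, where $\square f=-\operatorname{div}\operatorname{grad}f$. Let $U\subseteq M$ be open and geodesically convex, i.e. for every $x\in U$ the exponential map $\exp_x$ maps some open subset of $T_xM$ that is star-shaped about $0$ diffeomorphically onto $U$; for $x,y\in U$ put $$\Gamma(y,x)=-g_x\big(\exp_x^{-1}(y),\exp_x^{-1}(y)\big).$$ For a smooth section $V$ of $E\boxtimes E^*$ over $U\times U$ (so that $V(y,x)\in\operatorname{Hom}(E_x,E_y)$) put $$\rho V=\nabla_{\operatorname{grad}\Gamma}V-\big(\tfrac12\square\Gamma-d\big)V,$$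 where $\nabla$, $\operatorname{grad}$, $\square$ and also $P$ act in the first variable $y$. A family $(V^k)_{k\in\mathbb N}$ of smooth sections of $E\boxtimes E^*$ over $U\times U$ is called the family of Hadamard coefficients of $P$ on $U$ if it satisfies the transport equations $$\rho V^0=0,\qquad (\rho-2k)V^k=2k\,PV^{k-1}\quad(k\ge1),$$ and the initial condition $V^0(x,x)=\mathrm{id}_{E_x}$ for all $x\in U$. Let $(V^k)_{k\in\mathbb N}$ be the Hadamard coefficients of $P$ on $U$ and let $z\in\mathbb C$. Then the sections $$V^k(z)=\sum_{m=0}^k\binom km z^m\,V^{k-m}\qquad(k\in\mathbb N)$$ are the Hadamard coefficients of $P-z$ on $U$: the family $(V^k(z))_{k\in\mathbb N}$ satisfies the above conditions for $P-z$ in place of $P$, and every family that satisfies them for $P-z$ is equal to it on $U\times U$. -/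

import Mathlib

open Bundle Set Filter
open scoped Manifold ContDiff Topology

set_option linter.unusedSectionVars false

noncomputable section

/-- Real scalar multiplication is continuous on a complex topological vector space. -/
instance continuousSMulRealOfComplex (V : Type*) [TopologicalSpace V] [AddCommGroup V]
    [Module ℂ V] [ContinuousSMul ℂ V] : ContinuousSMul ℝ V :=
  IsScalarTower.continuousSMul ℂ

/-! ## Lorentzian geometry -/

section Lorentz

variable {d : ℕ} {M : Type*} [TopologicalSpace M] [ChartedSpace (EuclideanSpace ℝ (Fin d)) M]
  [IsManifold (𝓡 d) ∞ M]

variable (d M) in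
/-- A smooth Lorentzian metric of signature `(-,+,…,+)` on the `d`-dimensional manifold `M`. -/
structure LorentzMetric where
  /-- the scalar product on each tangent space -/
  inner (x : M) : TangentSpace (𝓡 d) x →L[ℝ] TangentSpace (𝓡 d) x →L[ℝ] ℝ
  symm (x : M) (v w : TangentSpace (𝓡 d) x) : inner x v w = inner x w v
  /-- there is a timelike vector, and the form is positive definite on its orthogonal complement -/
  signature (x : M) : ∃ v : TangentSpace (𝓡 d) x, inner x v v < 0 ∧
    ∀ w : TangentSpace (𝓡 d) x, w ≠ 0 → inner x v w = 0 → 0 < inner x w w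
  contMDiff : ContMDiff (𝓡 d)
    ((𝓡 d).prod 𝓘(ℝ, EuclideanSpace ℝ (Fin d) →L[ℝ] EuclideanSpace ℝ (Fin d) →L[ℝ] ℝ)) ∞
    (fun x ↦ TotalSpace.mk'
      (EuclideanSpace ℝ (Fin d) →L[ℝ] EuclideanSpace ℝ (Fin d) →L[ℝ] ℝ) x (inner x))

namespace LorentzMetric

variable (g : LorentzMetric d M)

theorem nondegenerate (x : M) (u : TangentSpace (𝓡 d) x) (h : ∀ w, g.inner x u w = 0) :
    u = 0 := by
  obtain ⟨v, -, hpos⟩ := g.signature x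
  by_contra hu
  have h1 := hpos u hu (by rw [g.symm]; exact h v)
  rw [h u] at h1
  exact lt_irrefl _ h1

/-- Riesz representation with respect to the nondegenerate form `g` at `x`. -/
theorem exists_representative (x : M) (l : TangentSpace (𝓡 d) x →L[ℝ] ℝ) :
    ∃ v : TangentSpace (𝓡 d) x, ∀ w, g.inner x v w = l w := by
  let T : EuclideanSpace ℝ (Fin d) →ₗ[ℝ] (EuclideanSpace ℝ (Fin d) →L[ℝ] ℝ) :=
    (g.inner x).toLinearMap
  have hinj : Function.Injective T := by
    rw [← LinearMap.ker_eq_bot, LinearMap.ker_eq_bot']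
    intro u hu
    exact g.nondegenerate x u fun w ↦ DFunLike.congr_fun hu w
  have hdim : Module.finrank ℝ (EuclideanSpace ℝ (Fin d)) =
      Module.finrank ℝ (EuclideanSpace ℝ (Fin d) →L[ℝ] ℝ) :=
    (InnerProductSpace.toDual ℝ (EuclideanSpace ℝ (Fin d))).toLinearEquiv.finrank_eq
  obtain ⟨v, hv⟩ := (LinearMap.injective_iff_surjective_of_finrank_eq_finrank hdim).1 hinj l
  exact ⟨v, fun w ↦ DFunLike.congr_fun hv w⟩

/-- The gradient: the tangent vector at `y` with `g (grad f) w = df w` for all `w`. -/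
def grad (f : M → ℝ) (y : M) : TangentSpace (𝓡 d) y :=
  (g.exists_representative y (mvfderiv (𝓡 d) f y)).choose

/-- The metric in the preferred chart `φ` around `x₀`: the bilinear form
`(v, w) ↦ g (Dφ⁻¹ v) (Dφ⁻¹ w)` at the coordinate point `p`. -/
def inChart (x₀ : M) (p v w : EuclideanSpace ℝ (Fin d)) : ℝ :=
  g.inner ((extChartAt (𝓡 d) x₀).symm p)
    (mfderiv 𝓘(ℝ, EuclideanSpace ℝ (Fin d)) (𝓡 d) (extChartAt (𝓡 d) x₀).symm p v)
    (mfderiv 𝓘(ℝ, EuclideanSpace ℝ (Fin d)) (𝓡 d) (extChartAt (𝓡 d) x₀).symm p w)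

/-- The matrix `(g_ij)` of the metric in the preferred chart around `x₀`. -/
def gram (x₀ : M) (p : EuclideanSpace ℝ (Fin d)) : Matrix (Fin d) (Fin d) ℝ :=
  Matrix.of fun i j ↦ g.inChart x₀ p (EuclideanSpace.single i 1) (EuclideanSpace.single j 1)

/-- The partial derivative `∂_i h` at `p`. -/
def _root_.partialDeriv (i : Fin d) (h : EuclideanSpace ℝ (Fin d) → ℝ)
    (p : EuclideanSpace ℝ (Fin d)) : ℝ :=
  fderiv ℝ h p (EuclideanSpace.single i 1)

/-- The d'Alembert operator `□ f = - div (grad f)`, written at `y` in the preferred chart `φ`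
around `y`: `- |det g|^(-1/2) ∑_ij ∂_i (|det g|^(1/2) g^ij ∂_j (f ∘ φ⁻¹))`. -/
def dAlembert (f : M → ℝ) (y : M) : ℝ :=
  -((Real.sqrt |(g.gram y (extChartAt (𝓡 d) y y)).det|)⁻¹ *
    ∑ i, ∑ j, partialDeriv i
      (fun p ↦ Real.sqrt |(g.gram y p).det| * (g.gram y p)⁻¹ i j *
        partialDeriv j (f ∘ (extChartAt (𝓡 d) y).symm) p)
      (extChartAt (𝓡 d) y y))

/-- `c` is an (affinely parametrized) geodesic on the open set `J` of times: it is smooth, and with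
`q = φ ∘ c` for the preferred chart `φ` around `c t` it satisfies at each time `t` the geodesic
equation `d/dt (g_kj(q) q'^j) = 1/2 ∂_k g_ij(q) q'^i q'^j`, which is the equation
`q''^k + Γ^k_ij q'^i q'^j = 0` with its free index lowered (here paired with a vector `w`). -/
def IsGeodesicOn (c : ℝ → M) (J : Set ℝ) : Prop :=
  ContMDiffOn 𝓘(ℝ, ℝ) (𝓡 d) ∞ c J ∧
  ∀ t ∈ J, ∀ w : EuclideanSpace ℝ (Fin d),
    let q : ℝ → EuclideanSpace ℝ (Fin d) := fun s ↦ extChartAt (𝓡 d) (c t) (c s)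
    deriv (fun s ↦ g.inChart (c t) (q s) (deriv q s) w) t =
      1 / 2 * fderiv ℝ (fun p ↦ g.inChart (c t) p (deriv q t) (deriv q t)) (q t) w

/-- `L` is the inverse of the exponential map `exp_x`, as a diffeomorphism from `U` onto an open
subset of `T_x M` that is star-shaped about `0`: for each `ξ` in its target,
`t ↦ L⁻¹ (t ξ)` is the geodesic that starts at `x` with velocity `ξ`.
(As a vector space, `T_x M` is `EuclideanSpace ℝ (Fin d)` by definition.) -/
structure IsExpInverse (U : Set M) (x : M)
    (L : OpenPartialHomeomorph M (EuclideanSpace ℝ (Fin d))) : Prop where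
  source_eq : L.source = U
  starConvex : StarConvex ℝ 0 L.target
  smooth : ContMDiffOn (𝓡 d) 𝓘(ℝ, EuclideanSpace ℝ (Fin d)) ∞ L U
  smooth_symm : ContMDiffOn 𝓘(ℝ, EuclideanSpace ℝ (Fin d)) (𝓡 d) ∞ L.symm L.target
  map_base : L x = 0
  geodesic : ∀ ξ ∈ L.target, g.IsGeodesicOn (fun t : ℝ ↦ L.symm (t • ξ)) {t | t • ξ ∈ L.target}
  velocity : ∀ ξ ∈ L.target,
    mfderiv 𝓘(ℝ, ℝ) (𝓡 d) (fun t : ℝ ↦ L.symm (t • ξ)) 0 (1 : ℝ) = ξ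

/-- `U` is geodesically convex: for each of its points `x` the exponential map `exp_x` maps an
open subset of `T_x M`, star-shaped about `0`, diffeomorphically onto `U`. -/
def IsGeodesicallyConvex (U : Set M) : Prop :=
  ∀ x ∈ U, ∃ L, g.IsExpInverse U x L

open Classical in
/-- The function `Γ(y,x) = - g (exp_x⁻¹ y) (exp_x⁻¹ y)` for `x, y` in the convex set `U`
(the map `exp_x⁻¹` on `U` is unique; the value off `U × U` is irrelevant). -/
def Gam (U : Set M) (y x : M) : ℝ :=
  if h : ∃ L, g.IsExpInverse U x L then -g.inner x (h.choose y) (h.choose y) else 0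

end LorentzMetric

end Lorentz

/-! ## Sections of a complex vector bundle and normally hyperbolic operators -/

section Operators

variable {d : ℕ} {M : Type*} [TopologicalSpace M] [ChartedSpace (EuclideanSpace ℝ (Fin d)) M]
  [IsManifold (𝓡 d) ∞ M]
  (F : Type*) [NormedAddCommGroup F] [NormedSpace ℂ F]
  (E : M → Type*) [TopologicalSpace (TotalSpace F E)]
  [∀ x, AddCommGroup (E x)] [∀ x, Module ℂ (E x)] [∀ x, TopologicalSpace (E x)]
  [FiberBundle F E] [VectorBundle ℂ F E] [VectorBundle ℝ F E]

theorem contMDiff_complex_smul_section {s : ∀ x, E x} (z : ℂ)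
    (hs : ContMDiff (𝓡 d) ((𝓡 d).prod 𝓘(ℝ, F)) ∞ (fun x ↦ TotalSpace.mk' F x (s x))) :
    ContMDiff (𝓡 d) ((𝓡 d).prod 𝓘(ℝ, F)) ∞ (fun x ↦ TotalSpace.mk' F x ((z • s) x)) := by
  intro x₀
  have h := hs x₀
  rw [contMDiffAt_section] at h ⊢
  have h2 : ContMDiffAt (𝓡 d) 𝓘(ℝ, F) ∞
      (fun x ↦ (z • ContinuousLinearMap.id ℝ F) (trivializationAt F E x₀ ⟨x, s x⟩).2) x₀ :=
    (z • ContinuousLinearMap.id ℝ F).contMDiff.contMDiffAt.comp x₀ h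
  refine h2.congr_of_eventuallyEq ?_
  filter_upwards [(trivializationAt F E x₀).open_baseSet.mem_nhds
    (FiberBundle.mem_baseSet_trivializationAt' x₀)] with x hx
  exact ((trivializationAt F E x₀).linear ℂ hx).2 z (s x)

variable (d) in
/-- The complex vector space `Γ(E)` of smooth sections of the complex vector bundle `E`. -/
def SmoothSections : Submodule ℂ (∀ x, E x) where
  carrier := {s | ContMDiff (𝓡 d) ((𝓡 d).prod 𝓘(ℝ, F)) ∞ (fun x ↦ TotalSpace.mk' F x (s x))}
  add_mem' hs ht := ContMDiff.add_section hs ht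
  zero_mem' := Bundle.contMDiff_zeroSection ℝ E
  smul_mem' z _ hs := contMDiff_complex_smul_section F E z hs

/-- Multiplication of smooth sections by a smooth real function. -/
def mulFun (f : C^∞⟮𝓡 d, M; ℝ⟯) : Module.End ℂ (SmoothSections d F E) where
  toFun s := ⟨fun x ↦ f x • s.1 x, ContMDiff.smul_section f.contMDiff s.2⟩
  map_add' s t := by
    ext x
    exact smul_add (f x) (s.1 x) (t.1 x)
  map_smul' z s := by
    ext x
    exact smul_comm (f x) z (s.1 x)

variable {F E}

/-- `P` is a (linear) differential operator of order at most `n`: all `(n+1)`-fold commutators with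
multiplications by smooth functions vanish. -/
def IsDiffOp : ℕ → Module.End ℂ (SmoothSections d F E) → Prop
  | 0, P => ∀ f, P * mulFun F E f - mulFun F E f * P = 0
  | n + 1, P => ∀ f, IsDiffOp n (P * mulFun F E f - mulFun F E f * P)

/-- `P` is normally hyperbolic: a differential operator of second order whose principal symbol,
which at the covector `df` is half the double commutator of `P` with `f`, is minus the metric. -/
def IsNormallyHyperbolic (g : LorentzMetric d M) (P : Module.End ℂ (SmoothSections d F E)) :
    Prop :=
  IsDiffOp 2 P ∧
  ∀ (f : C^∞⟮𝓡 d, M; ℝ⟯) (s : SmoothSections d F E) (y : M),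
    let Q := P * mulFun F E f - mulFun F E f * P
    (1 / 2 : ℝ) • ((Q * mulFun F E f - mulFun F E f * Q) s).1 y =
      (-g.inner y (g.grad f y) (g.grad f y)) • s.1 y

open Classical in
/-- The value at `y` of the differential operator `P` applied to a section `s` that is only defined
and smooth near `y`: `P` is applied to any global smooth section with the same germ at `y`, on
which the value does not depend since `P` is local. -/
def applyLocal (P : Module.End ℂ (SmoothSections d F E)) (s : ∀ x, E x) (y : M) : E y :=
  if h : ∃ t : SmoothSections d F E, ∀ᶠ x in 𝓝 y, t.1 x = s x then (P h.choose).1 y else 0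

variable [∀ x, IsTopologicalAddGroup (E x)] [∀ x, ContinuousSMul ℂ (E x)]

/-- `nabla` is the connection induced by the normally hyperbolic operator `P`: the (unique) smooth
connection on `E` with the Leibniz rule `P (f s) = f P s - 2 ∇_{grad f} s + (□ f) s`. Note that
`nabla s y v` denotes the derivative of `s` at `y` in the direction `v`. -/
def IsInducedConnection (g : LorentzMetric d M) (P : Module.End ℂ (SmoothSections d F E))
    (nabla : CovariantDerivative (𝓡 d) F E) : Prop :=
  CovariantDerivative.ContMDiffCovariantDerivative nabla ∞ ∧
  ∀ (f : C^∞⟮𝓡 d, M; ℝ⟯) (s : SmoothSections d F E) (y : M),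
    (P (mulFun F E f s)).1 y =
      f y • (P s).1 y - (2 : ℝ) • nabla s.1 y (g.grad f y) + g.dAlembert f y • s.1 y

/-! ## Hadamard coefficients -/

variable (E) in
/-- Sections `V(y,x)` of `E ⊠ E*`, the fibre of which over `(y,x)` is `E_y ⊗ E_x* = Hom(E_x,E_y)`
(all fibres are finite-dimensional). -/
abbrev BiSection := ∀ y x : M, E x →L[ℂ] E y

/-- `V` is a smooth section of `E ⊠ E*` over the open set `U × U`: near each point `(y₀,x₀)`, its
matrix in the local trivializations of `E` around `y₀` and `x₀` is smooth. -/
def BiSection.IsSmoothOn (V : BiSection E) (U : Set M) : Prop :=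
  ∀ y₀ ∈ U, ∀ x₀ ∈ U, ContMDiffAt ((𝓡 d).prod (𝓡 d)) 𝓘(ℝ, F →L[ℂ] F) ∞
    (fun q : M × M ↦ ContinuousLinearMap.inCoordinates F E F E x₀ q.2 y₀ q.1 (V q.1 q.2)) (y₀, x₀)

/-- The operator `ρ V = ∇_{grad Γ} V - (1/2 □ Γ - d) V`, acting in the first variable, at `(y,x)`
and applied to `e ∈ E_x`. -/
def rho (g : LorentzMetric d M) (U : Set M) (nabla : CovariantDerivative (𝓡 d) F E)
    (V : BiSection E) (y x : M) (e : E x) : E y :=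
  nabla (fun y' ↦ V y' x e) y (g.grad (fun y' ↦ g.Gam U y' x) y)
    - (1 / 2 * g.dAlembert (fun y' ↦ g.Gam U y' x) y - d) • V y x e

/-- `V 0, V 1, …` are the Hadamard coefficients of `P` on `U`: smooth sections of `E ⊠ E*` over
`U × U` with the transport equations `(ρ - 2k) V^k = 2k P V^{k-1}` (with right hand side `0` for
`k = 0`) and the initial condition `V^0(x,x) = 1`; `P` acts in the first variable and the
connection in `ρ` is the one that `P` induces. -/
def IsHadamardFamily (g : LorentzMetric d M) (U : Set M)
    (P : Module.End ℂ (SmoothSections d F E)) (V : ℕ → BiSection E) : Prop :=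
  (∀ k, BiSection.IsSmoothOn (d := d) (F := F) (V k) U) ∧
  (∃ nabla : CovariantDerivative (𝓡 d) F E, IsInducedConnection g P nabla ∧
    (∀ y ∈ U, ∀ x ∈ U, ∀ e : E x, rho g U nabla (V 0) y x e = 0) ∧
    (∀ k : ℕ, 1 ≤ k → ∀ y ∈ U, ∀ x ∈ U, ∀ e : E x,
      rho g U nabla (V k) y x e - (2 * k : ℂ) • V k y x e =
        (2 * k : ℂ) • applyLocal P (fun y' ↦ V (k - 1) y' x e) y)) ∧
  ∀ x ∈ U, V 0 x x = ContinuousLinearMap.id ℂ (E x)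

end Operators

end

/-! Existence is algebra. Subtracting the constant `z` leaves the commutators of `P` with functions
unchanged, hence the induced connection and ρ as well. The transport equations for `P` can be
written uniformly as ρ V^j = 2j (P V^{j-1} + V^j), including j = 0. Applying ρ to the binomial sum
and comparing coefficients leaves the two absorption identities (k-m) C(k,m) = k C(k-1,m) and m
C(k,m) = k C(k-1,m-1) (`binomial_transport`).

Uniqueness is an induction on k: if two families agree at level k-1, the difference D of their k-th
members solves (ρ - 2k) D = 0, and for k = 0 it vanishes on the diagonal. The Gauss lemma shows that
grad Γ is -2 times the radial field of the exponential map at x (`grad_neg_inner`), so this equation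
is an ordinary differential equation along each radial geodesic, singular only at the pole x.

At the pole, V^0(·,x) applied to a basis of E_x is a frame of solutions of ρ W = 0. The coefficients
of D in this frame satisfy the Euler equation t a' = -k a, whose only solution regular at 0 is zero,
given a(0) = 0 when k = 0 (`eventually_eq_zero_at_pole`). Away from the pole the equation is a
regular linear system and zeros propagate (`eventually_eq_zero_of_ne`). A connectedness argument on
[0,1] joins the two (`eq_zero_of_transport`).

Since `P` acts on global sections while Γ and the coefficients are only controlled on U, the
argument works with germs: bump functions extend them, and the transport operator is replaced by
-1/2 [P, f] + d with f a global extension of the germ of Γ (`transport_eq`). -/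

noncomputable section


/-! ### One-variable equations and the Gauss lemma in a vector space -/

section Calculus

/-- A continuous function on `[0, b]` whose derivative vanishes on `(0, b)` has equal values at the ends. -/
theorem eq_of_hasDerivAt_zero_of_continuousOn {f : ℝ → ℝ} {b : ℝ} (hb : 0 ≤ b)
    (hc : ContinuousOn f (Icc 0 b)) (hd : ∀ t ∈ Ioo 0 b, HasDerivAt f 0 t) : f b = f 0 := by
  have hi : interior (Icc (0 : ℝ) b) = Ioo 0 b := interior_Icc
  have h1 : MonotoneOn f (Icc 0 b) := monotoneOn_of_deriv_nonneg (convex_Icc 0 b) hc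
    (fun t ht ↦ (hd t (hi ▸ ht)).differentiableAt.differentiableWithinAt)
    (fun t ht ↦ (hd t (hi ▸ ht)).deriv.ge)
  have h2 : AntitoneOn f (Icc 0 b) := antitoneOn_of_deriv_nonpos (convex_Icc 0 b) hc
    (fun t ht ↦ (hd t (hi ▸ ht)).differentiableAt.differentiableWithinAt)
    (fun t ht ↦ (hd t (hi ▸ ht)).deriv.le)
  exact le_antisymm (h2 (left_mem_Icc.2 hb) (right_mem_Icc.2 hb) hb)
    (h1 (left_mem_Icc.2 hb) (right_mem_Icc.2 hb) hb)

/-- A solution of the Euler equation `t φ' = - k φ` that is regular at `0` vanishes for `t ≥ 0`,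
provided that `0 < k` or `φ 0 = 0`. -/
theorem eventually_eq_zero_of_euler {φ : ℝ → ℝ} {k : ℕ} (hk : k = 0 → φ 0 = 0)
    (h : ∀ᶠ t in 𝓝 0, DifferentiableAt ℝ φ t ∧ t * deriv φ t = -(k * φ t)) :
    ∀ᶠ t in 𝓝 0, 0 ≤ t → φ t = 0 := by
  obtain ⟨ε, hε, hball⟩ := Metric.eventually_nhds_iff.1 h
  refine Metric.eventually_nhds_iff.2 ⟨ε, hε, fun b hb h0 ↦ ?_⟩
  have hin : ∀ t ∈ Icc 0 b, dist t 0 < ε := fun t ht ↦ by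
    rw [Real.dist_0_eq_abs, abs_of_nonneg ht.1]
    rw [Real.dist_0_eq_abs, abs_of_nonneg h0] at hb
    exact ht.2.trans_lt hb
  have hφ0 : φ 0 = 0 := by
    rcases Nat.eq_zero_or_pos k with h | h
    · exact hk h
    -- For positive k the equation itself at t = 0 forces k φ(0) = 0.
    · have h1 := (hball (hin 0 ⟨le_rfl, h0⟩)).2
      have h2 : (k : ℝ) * φ 0 = 0 := by linarith [zero_mul (deriv φ 0)]
      exact (mul_eq_zero.1 h2).resolve_left (by positivity)
  -- The integrating factor is t^k: the equation says that t^k φ is constant.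
  have hconst := eq_of_hasDerivAt_zero_of_continuousOn (f := fun t ↦ t ^ k * φ t) h0
    (fun t ht ↦ ((continuous_pow k).continuousAt.mul
      (hball (hin t ht)).1.continuousAt).continuousWithinAt)
    (fun t ht ↦ by
      obtain ⟨h1, h2⟩ := hball (hin t ⟨ht.1.le, ht.2.le⟩)
      convert! (hasDerivAt_pow k t).mul h1.hasDerivAt using 1
      have ht0 : t ≠ 0 := ht.1.ne'
      apply mul_left_cancel₀ ht0
      rcases k with _ | k
      · simp at h2 ⊢
        tauto
      · simp only [Nat.add_sub_cancel, pow_succ] at h2 ⊢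
        linear_combination (-(t ^ k * t)) * h2)
  rcases h0.eq_or_lt with rfl | hpos
  · exact hφ0
  · simp only [hφ0, mul_zero] at hconst
    exact (mul_eq_zero.1 hconst).resolve_left (pow_ne_zero _ hpos.ne')

/-- A solution of a linear ordinary differential equation with continuous coefficients that
vanishes at a point vanishes near it. -/
theorem eventually_eq_zero_of_linear_ode {W : Type*} [NormedAddCommGroup W] [NormedSpace ℝ W]
    {A : ℝ → W →L[ℝ] W} {u : ℝ → W} {t₀ : ℝ} (hA : ContinuousAt A t₀)
    (hu : ∀ᶠ t in 𝓝 t₀, HasDerivAt u (A t (u t)) t) (h0 : u t₀ = 0) :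
    ∀ᶠ t in 𝓝 t₀, u t = 0 := by
  obtain ⟨K, hK⟩ : ∃ K : NNReal, ∀ᶠ t in 𝓝 t₀, ‖A t‖₊ < K :=
    ⟨‖A t₀‖₊ + 1, hA.nnnorm.eventually (gt_mem_nhds (lt_add_one _))⟩
  have hz : u =ᶠ[𝓝 t₀] fun _ ↦ (0 : W) :=
    ODE_solution_unique_of_eventually (v := fun t w ↦ A t w) (s := fun _ ↦ univ) (K := K)
      (hK.mono fun t ht ↦ ((A t).lipschitz.weaken ht.le).lipschitzOnWith)
      (hu.mono fun t ht ↦ ⟨ht, mem_univ _⟩)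
      (Eventually.of_forall fun t ↦ ⟨by simpa using hasDerivAt_const t (0 : W), mem_univ _⟩) h0
  exact hz

variable {X : Type*} [NormedAddCommGroup X] [NormedSpace ℝ X]

set_option synthInstance.maxHeartbeats 400000 in
/-- The geodesic equation of a metric `B` in lowered form, transported along a change of
coordinates `θ`: it is stated for the straight line with velocity `ξ` in the new coordinates, in
which the metric is `G`. -/
theorem euler_lagrange_comp {B G : X → X →L[ℝ] X →L[ℝ] ℝ} {θ : X → X} {t : ℝ} {ξ v : X}
    (hθ : ContDiffAt ℝ 2 θ (t • ξ)) (hB : DifferentiableAt ℝ B (θ (t • ξ)))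
    (hsymm : ∀ a b, B (θ (t • ξ)) a b = B (θ (t • ξ)) b a)
    (hG : ∀ᶠ η in 𝓝 (t • ξ), ∀ a b, G η a b = B (θ η) (fderiv ℝ θ η a) (fderiv ℝ θ η b))
    (hGd : DifferentiableAt ℝ G (t • ξ))
    (hgeo : deriv (fun s : ℝ ↦ B (θ (s • ξ)) (deriv (fun s : ℝ ↦ θ (s • ξ)) s)
        (fderiv ℝ θ (t • ξ) v)) t =
      1 / 2 * fderiv ℝ (fun p ↦ B p (deriv (fun s : ℝ ↦ θ (s • ξ)) t)
        (deriv (fun s : ℝ ↦ θ (s • ξ)) t)) (θ (t • ξ)) (fderiv ℝ θ (t • ξ) v)) :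
    fderiv ℝ G (t • ξ) ξ ξ v = 1 / 2 * fderiv ℝ G (t • ξ) v ξ ξ := by
  set η₀ := t • ξ with hη₀
  have hθ1 : DifferentiableAt ℝ θ η₀ := hθ.differentiableAt (by norm_num)
  have hθ2 : DifferentiableAt ℝ (fderiv ℝ θ) η₀ :=
    (hθ.fderiv_right (m := 1) (by norm_num)).differentiableAt (by norm_num)
  have hθev : ∀ᶠ η in 𝓝 η₀, DifferentiableAt ℝ θ η :=
    (hθ.eventually (by simp)).mono fun η h ↦ h.differentiableAt (by norm_num)
  have hsym2 : ∀ a b, fderiv ℝ (fderiv ℝ θ) η₀ a b = fderiv ℝ (fderiv ℝ θ) η₀ b a :=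
    hθ.isSymmSndFDerivAt (by simp)
  have hline : ∀ s : ℝ, HasDerivAt (fun s : ℝ ↦ s • ξ) ξ s := fun s ↦ by
    simpa using (hasDerivAt_id s).smul_const ξ
  have hlinec : Tendsto (fun s : ℝ ↦ s • ξ) (𝓝 t) (𝓝 η₀) := (hline t).continuousAt
  have hq : ∀ᶠ s in 𝓝 t, deriv (fun s : ℝ ↦ θ (s • ξ)) s = fderiv ℝ θ (s • ξ) ξ :=
    (hlinec.eventually hθev).mono fun s hs ↦
      (hs.hasFDerivAt.comp_hasDerivAt s (hline s)).deriv
  have hGval : ∀ c a b, fderiv ℝ G η₀ c a b =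
      fderiv ℝ B (θ η₀) (fderiv ℝ θ η₀ c) (fderiv ℝ θ η₀ a) (fderiv ℝ θ η₀ b) +
      B (θ η₀) (fderiv ℝ (fderiv ℝ θ) η₀ c a) (fderiv ℝ θ η₀ b) +
      B (θ η₀) (fderiv ℝ θ η₀ a) (fderiv ℝ (fderiv ℝ θ) η₀ c b) := by
    intro c a b
    have e1 : HasFDerivAt (fun η ↦ G η a b) _ η₀ :=
      (hGd.hasFDerivAt.clm_apply (hasFDerivAt_const a η₀)).clm_apply (hasFDerivAt_const b η₀)
    have e2 : HasFDerivAt (fun η ↦ B (θ η) (fderiv ℝ θ η a) (fderiv ℝ θ η b)) _ η₀ :=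
      ((hB.hasFDerivAt.comp η₀ hθ1.hasFDerivAt).clm_apply
        (hθ2.hasFDerivAt.clm_apply (hasFDerivAt_const a η₀))).clm_apply
        (hθ2.hasFDerivAt.clm_apply (hasFDerivAt_const b η₀))
    have e3 := e1.unique (e2.congr_of_eventuallyEq (hG.mono fun η h ↦ h a b))
    have e4 := DFunLike.congr_fun e3 c
    simp at e4
    rw [e4]
    ring
  have hleft : deriv (fun s : ℝ ↦ B (θ (s • ξ)) (deriv (fun s : ℝ ↦ θ (s • ξ)) s)
        (fderiv ℝ θ η₀ v)) t =
      fderiv ℝ B (θ η₀) (fderiv ℝ θ η₀ ξ) (fderiv ℝ θ η₀ ξ) (fderiv ℝ θ η₀ v) +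
      B (θ η₀) (fderiv ℝ (fderiv ℝ θ) η₀ ξ ξ) (fderiv ℝ θ η₀ v) := by
    have e2 : HasFDerivAt (fun η ↦ B (θ η) (fderiv ℝ θ η ξ) (fderiv ℝ θ η₀ v)) _ η₀ :=
      ((hB.hasFDerivAt.comp η₀ hθ1.hasFDerivAt).clm_apply
        (hθ2.hasFDerivAt.clm_apply (hasFDerivAt_const ξ η₀))).clm_apply
        (hasFDerivAt_const (fderiv ℝ θ η₀ v) η₀)
    have e3 := (e2.comp_hasDerivAt t (hline t)).congr_of_eventuallyEq
      (f₁ := fun s : ℝ ↦ B (θ (s • ξ)) (deriv (fun s : ℝ ↦ θ (s • ξ)) s) (fderiv ℝ θ η₀ v))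
      (hq.mono fun s hs ↦ by simp [hs])
    rw [e3.deriv]
    simp
    ring
  have hright : fderiv ℝ (fun p ↦ B p (fderiv ℝ θ η₀ ξ) (fderiv ℝ θ η₀ ξ)) (θ η₀)
        (fderiv ℝ θ η₀ v) =
      fderiv ℝ B (θ η₀) (fderiv ℝ θ η₀ v) (fderiv ℝ θ η₀ ξ) (fderiv ℝ θ η₀ ξ) := by
    have e1 : HasFDerivAt (fun p ↦ B p (fderiv ℝ θ η₀ ξ) (fderiv ℝ θ η₀ ξ)) _ (θ η₀) :=
      (hB.hasFDerivAt.clm_apply (hasFDerivAt_const _ _)).clm_apply (hasFDerivAt_const _ _)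
    rw [e1.fderiv]
    simp
  rw [hleft, hq.self_of_nhds, hright] at hgeo
  -- The second derivatives of θ cancel: by symmetry of B and of D²θ, half of the two such terms in
  -- the derivative along v is exactly the term B(Dθ ξ, D²θ(ξ,v)) on the left. What remains is the
  -- geodesic equation.
  rw [hGval, hGval, hsym2 v ξ, hsymm (fderiv ℝ (fderiv ℝ θ) η₀ ξ v)]
  linarith

set_option synthInstance.maxHeartbeats 400000 in
/-- The Gauss lemma in normal coordinates: if the straight rays from `0` satisfy the geodesic
equation of the metric `G` on a star-shaped open set, then `G η (η, v) = G 0 (η, v)`. -/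
theorem gauss_of_euler_lagrange {G : X → X →L[ℝ] X →L[ℝ] ℝ} {T : Set X} (hT : IsOpen T)
    (hstar : StarConvex ℝ 0 T) (hG : ∀ η ∈ T, DifferentiableAt ℝ G η)
    (hsymm : ∀ η ∈ T, ∀ a b, G η a b = G η b a)
    (hEL : ∀ η ∈ T, ∀ v, fderiv ℝ G η η η v = 1 / 2 * fderiv ℝ G η v η η) {η : X} (hη : η ∈ T)
    (v : X) : G η η v = G 0 η v := by
  have hray : ∀ η ∈ T, ∀ t ∈ Icc (0 : ℝ) 1, t • η ∈ T := fun η hη t ht ↦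
    hstar.smul_mem hη ht.1 ht.2
  have hder : ∀ η ∈ T, ∀ a b, ∀ t ∈ Icc (0 : ℝ) 1,
      HasDerivAt (fun t : ℝ ↦ G (t • η) a b) (fderiv ℝ G (t • η) η a b) t := by
    intro η hη a b t ht
    have hline : HasDerivAt (fun s : ℝ ↦ s • η) η t := by
      simpa using (hasDerivAt_id t).smul_const η
    have e1 : HasFDerivAt (fun η ↦ G η a b) _ (t • η) :=
      ((hG _ (hray η hη t ht)).hasFDerivAt.clm_apply (hasFDerivAt_const a _)).clm_apply
        (hasFDerivAt_const b _)
    convert! e1.comp_hasDerivAt t hline using 1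
    simp
  -- Conservation of energy: with v along the ray the Euler-Lagrange equation equates a number with
  -- half of itself, so G(tη)(η,η) is constant in t.
  have hnorm : ∀ η ∈ T, G η η η = G 0 η η := by
    intro η hη
    have := eq_of_hasDerivAt_zero_of_continuousOn (f := fun t : ℝ ↦ G (t • η) η η) zero_le_one
      (fun t ht ↦ (hder η hη η η t ht).continuousAt.continuousWithinAt)
      (fun t ht ↦ by
        have ht' : t ∈ Icc (0 : ℝ) 1 := ⟨ht.1.le, ht.2.le⟩
        convert! hder η hη η η t ht' using 1
        have h1 := hEL _ (hray η hη t ht') (t • η)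
        simp only [map_smul, FunLike.coe_smul, Pi.smul_apply, smul_eq_mul] at h1
        have h2 : t * (t * (t * fderiv ℝ G (t • η) η η η)) = 0 := by linarith
        have ht0 := ht.1.ne'
        simp only [mul_eq_zero, ht0, false_or] at h2
        exact h2.symm)
    simpa using this
  -- Differentiate the conserved energy identity with respect to η in direction v.
  have hpolar : ∀ η ∈ T, fderiv ℝ G η v η η + 2 * G η η v = 2 * G 0 η v := by
    intro η hη
    have h0 : (0 : X) ∈ T := by simpa using hray η hη 0 (by simp)
    have e1 : HasFDerivAt (fun η ↦ G η η η) _ η :=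
      ((hG η hη).hasFDerivAt.clm_apply (hasFDerivAt_id η)).clm_apply (hasFDerivAt_id η)
    have e2 : HasFDerivAt (fun η ↦ G 0 η η) _ η :=
      ((G 0).hasFDerivAt (x := η)).clm_apply (hasFDerivAt_id η)
    have e3 := e1.unique (e2.congr_of_eventuallyEq
      (by filter_upwards [hT.mem_nhds hη] with ζ hζ using hnorm ζ hζ))
    have e4 := DFunLike.congr_fun e3 v
    simp at e4
    rw [hsymm η hη v η, hsymm 0 h0 v η] at e4
    linarith
  -- Eliminating the v-derivative of G between `hEL` and `hpolar` at tη gives t δ' = -δ for δ(t) =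
  -- G(tη)(η,v) - G(0)(η,v). So t δ is constant; it vanishes at 0, hence at 1.
  have := eq_of_hasDerivAt_zero_of_continuousOn
    (f := fun t : ℝ ↦ t * (G (t • η) η v - G 0 η v)) zero_le_one
    (fun t ht ↦ (continuousAt_id.mul
      ((hder η hη η v t ht).continuousAt.sub continuousAt_const)).continuousWithinAt)
    (fun t ht ↦ by
      have ht' : t ∈ Icc (0 : ℝ) 1 := ⟨ht.1.le, ht.2.le⟩
      convert! (hasDerivAt_id t).mul ((hder η hη η v t ht').sub_const (G 0 η v)) using 1
      have h1 := hEL _ (hray η hη t ht') v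
      have h2 := hpolar _ (hray η hη t ht')
      simp only [map_smul, FunLike.coe_smul, Pi.smul_apply, smul_eq_mul] at h1 h2
      apply mul_left_cancel₀ ht.1.ne'
      simp only [id]
      linarith)
  simp only [one_mul, one_smul, zero_mul] at this
  linarith

end Calculus


/-! ### The metric in exponential coordinates -/

section NormalCoordinates

variable {d : ℕ} {M : Type*} [TopologicalSpace M] [ChartedSpace (EuclideanSpace ℝ (Fin d)) M]
  [IsManifold (𝓡 d) ∞ M]

/-- The derivative of a smooth parametrization of a manifold in a fixed direction is smooth. -/
theorem contMDiffAt_mfderiv_apply {ψ : EuclideanSpace ℝ (Fin d) → M}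
    {S : Set (EuclideanSpace ℝ (Fin d))} (hS : IsOpen S)
    (hψ : ContMDiffOn 𝓘(ℝ, EuclideanSpace ℝ (Fin d)) (𝓡 d) ∞ ψ S)
    (v : EuclideanSpace ℝ (Fin d)) {p : EuclideanSpace ℝ (Fin d)} (hp : p ∈ S) :
    ContMDiffAt 𝓘(ℝ, EuclideanSpace ℝ (Fin d)) (𝓡 d).tangent ∞
      (fun q ↦ (TotalSpace.mk' (EuclideanSpace ℝ (Fin d)) (ψ q)
        (mfderiv 𝓘(ℝ, EuclideanSpace ℝ (Fin d)) (𝓡 d) ψ q v) : TangentBundle (𝓡 d) M)) p := by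
  have h1 := hψ.contMDiffOn_tangentMapWithin (m := ∞) (by simp) hS.uniqueMDiffOn
  have h2 : ContMDiffAt 𝓘(ℝ, EuclideanSpace ℝ (Fin d)) 𝓘(ℝ, EuclideanSpace ℝ (Fin d)).tangent ∞
      (fun q ↦ (⟨q, v⟩ :
        TangentBundle 𝓘(ℝ, EuclideanSpace ℝ (Fin d)) (EuclideanSpace ℝ (Fin d)))) p :=
    contMDiffAt_vectorSpace_iff_contDiffAt.2 contDiffAt_const
  have h3 := (h1.contMDiffAt ((hS.preimage (FiberBundle.continuous_proj _ _)).mem_nhds hp)).comp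
    p h2
  refine h3.congr_of_eventuallyEq ?_
  filter_upwards [hS.mem_nhds hp] with q hq
  simp [tangentMapWithin, mfderivWithin_of_isOpen hS hq]

namespace LorentzMetric

variable (g : LorentzMetric d M)

/-- The pullback of the metric along a parametrization `ψ`. -/
def pullback (ψ : EuclideanSpace ℝ (Fin d) → M) (p : EuclideanSpace ℝ (Fin d)) :
    EuclideanSpace ℝ (Fin d) →L[ℝ] EuclideanSpace ℝ (Fin d) →L[ℝ] ℝ :=
  ContinuousLinearMap.bilinearComp (E := EuclideanSpace ℝ (Fin d))
    (F := EuclideanSpace ℝ (Fin d)) (g.inner (ψ p))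
    (mfderiv 𝓘(ℝ, EuclideanSpace ℝ (Fin d)) (𝓡 d) ψ p)
    (mfderiv 𝓘(ℝ, EuclideanSpace ℝ (Fin d)) (𝓡 d) ψ p)

theorem pullback_apply (ψ : EuclideanSpace ℝ (Fin d) → M) (p v w : EuclideanSpace ℝ (Fin d)) :
    g.pullback ψ p v w = g.inner (ψ p)
      (mfderiv 𝓘(ℝ, EuclideanSpace ℝ (Fin d)) (𝓡 d) ψ p v)
      (mfderiv 𝓘(ℝ, EuclideanSpace ℝ (Fin d)) (𝓡 d) ψ p w) := rfl

theorem pullback_symm (ψ : EuclideanSpace ℝ (Fin d) → M) (p v w : EuclideanSpace ℝ (Fin d)) :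
    g.pullback ψ p v w = g.pullback ψ p w v := g.symm _ _ _

/-- In finite dimensions it suffices to test on fixed v and w, where the value is the smooth metric
applied to two smooth vector fields along ψ. -/
theorem differentiableAt_pullback {ψ : EuclideanSpace ℝ (Fin d) → M}
    {S : Set (EuclideanSpace ℝ (Fin d))} (hS : IsOpen S)
    (hψ : ContMDiffOn 𝓘(ℝ, EuclideanSpace ℝ (Fin d)) (𝓡 d) ∞ ψ S)
    {p : EuclideanSpace ℝ (Fin d)} (hp : p ∈ S) : DifferentiableAt ℝ (g.pullback ψ) p := by
  have h : ContDiffOn ℝ ∞ (g.pullback ψ) S := by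
    rw [contDiffOn_clm_apply]
    intro v
    rw [contDiffOn_clm_apply]
    intro w q hq
    have hb : ContMDiffAt 𝓘(ℝ, EuclideanSpace ℝ (Fin d)) (𝓡 d) ∞ ψ q :=
      (hψ q hq).contMDiffAt (hS.mem_nhds hq)
    have h1 := ContMDiffAt.clm_bundle_apply₂ (F₁ := EuclideanSpace ℝ (Fin d))
      (E₁ := fun x : M ↦ TangentSpace (𝓡 d) x) (F₂ := EuclideanSpace ℝ (Fin d))
      (E₂ := fun x : M ↦ TangentSpace (𝓡 d) x) (F₃ := ℝ) (E₃ := Bundle.Trivial M ℝ)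
      (b := ψ) (n := ∞)
      (ψ := fun q ↦ g.inner (ψ q))
      (v := fun q ↦ mfderiv 𝓘(ℝ, EuclideanSpace ℝ (Fin d)) (𝓡 d) ψ q v)
      (w := fun q ↦ mfderiv 𝓘(ℝ, EuclideanSpace ℝ (Fin d)) (𝓡 d) ψ q w)
      ((g.contMDiff (ψ q)).comp q hb) (contMDiffAt_mfderiv_apply hS hψ v hq)
      (contMDiffAt_mfderiv_apply hS hψ w hq)
    have h2 := (contMDiffAt_totalSpace.1 h1).2
    exact (contMDiffAt_iff_contDiffAt.1 h2).contDiffWithinAt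
  exact (h.contDiffAt (hS.mem_nhds hp)).differentiableAt (by simp)

theorem pullback_comp {ψ : EuclideanSpace ℝ (Fin d) → M}
    {θ : EuclideanSpace ℝ (Fin d) → EuclideanSpace ℝ (Fin d)} {ψ' : EuclideanSpace ℝ (Fin d) → M}
    {p : EuclideanSpace ℝ (Fin d)}
    (hψ : MDifferentiableAt 𝓘(ℝ, EuclideanSpace ℝ (Fin d)) (𝓡 d) ψ (θ p))
    (hθ : DifferentiableAt ℝ θ p) (h : ψ' =ᶠ[𝓝 p] ψ ∘ θ) (v w : EuclideanSpace ℝ (Fin d)) :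
    g.pullback ψ' p v w = g.pullback ψ (θ p) (fderiv ℝ θ p v) (fderiv ℝ θ p w) := by
  have h1 : mfderiv 𝓘(ℝ, EuclideanSpace ℝ (Fin d)) (𝓡 d) (ψ ∘ θ) p = _ :=
    mfderiv_comp p hψ hθ.mdifferentiableAt
  have h2 := h.mfderiv_eq (I := 𝓘(ℝ, EuclideanSpace ℝ (Fin d))) (I' := 𝓡 d)
  have h3 := h.self_of_nhds
  have key : ∀ u, (mfderiv 𝓘(ℝ, EuclideanSpace ℝ (Fin d)) (𝓡 d) ψ' p :
      EuclideanSpace ℝ (Fin d) →L[ℝ] EuclideanSpace ℝ (Fin d)) u =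
      (mfderiv 𝓘(ℝ, EuclideanSpace ℝ (Fin d)) (𝓡 d) ψ (θ p) :
      EuclideanSpace ℝ (Fin d) →L[ℝ] EuclideanSpace ℝ (Fin d)) (fderiv ℝ θ p u) := by
    intro u
    rw [← mfderiv_eq_fderiv]
    exact (DFunLike.congr_fun h2 u).trans (DFunLike.congr_fun h1 u)
  have hinner : ∀ y y' : M, y = y' → ∀ a b : EuclideanSpace ℝ (Fin d),
      g.inner y a b = g.inner y' a b := by rintro y _ rfl a b; rfl
  change g.inner (ψ' p) _ _ = g.inner (ψ (θ p)) _ _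
  rw [hinner _ _ h3]
  exact congrArg₂ (fun a b : EuclideanSpace ℝ (Fin d) ↦ g.inner (ψ (θ p)) a b) (key v) (key w)

variable {g} {U : Set M} {x : M} {L : OpenPartialHomeomorph M (EuclideanSpace ℝ (Fin d))}

namespace IsExpInverse

theorem zero_mem_target (hL : g.IsExpInverse U x L) (hx : x ∈ U) : 0 ∈ L.target := by
  rw [← hL.map_base]
  exact L.map_source (hL.source_eq ▸ hx)

theorem symm_mem (hL : g.IsExpInverse U x L) {η : EuclideanSpace ℝ (Fin d)}
    (hη : η ∈ L.target) : L.symm η ∈ U := hL.source_eq ▸ L.map_target hη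

/-- The ray through η reaches η at time 1, so the geodesic equation at that single time, in the
preferred chart at `L.symm η`, is enough. The transition map θ carries it to exponential coordinates
by `euler_lagrange_comp`. -/
theorem euler_lagrange (hL : g.IsExpInverse U x L) {η : EuclideanSpace ℝ (Fin d)}
    (hη : η ∈ L.target) (v : EuclideanSpace ℝ (Fin d)) :
    fderiv ℝ (g.pullback L.symm) η η η v = 1 / 2 * fderiv ℝ (g.pullback L.symm) η v η η := by
  have hgeo := (hL.geodesic η hη).2 1 (by simpa using hη)
  simp only [one_smul] at hgeo
  set y := L.symm η with hy
  set θ : EuclideanSpace ℝ (Fin d) → EuclideanSpace ℝ (Fin d) :=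
    fun ζ ↦ extChartAt (𝓡 d) y (L.symm ζ) with hθdef
  have hev : ∀ᶠ ζ in 𝓝 η, ζ ∈ L.target ∧ L.symm ζ ∈ (extChartAt (𝓡 d) y).source :=
    (show ∀ᶠ ζ in 𝓝 η, ζ ∈ L.target from L.open_target.mem_nhds hη).and ((L.continuousAt_symm hη).eventually
      ((isOpen_extChartAt_source y).mem_nhds (mem_extChartAt_source y)))
  have hθev : ∀ ζ, ζ ∈ L.target → L.symm ζ ∈ (extChartAt (𝓡 d) y).source →
      ContDiffAt ℝ ∞ θ ζ := by
    intro ζ h1 h2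
    rw [extChartAt_source] at h2
    exact contMDiffAt_iff_contDiffAt.1 ((contMDiffAt_extChartAt' h2).comp ζ
      ((hL.smooth_symm ζ h1).contMDiffAt (L.open_target.mem_nhds h1)))
  have hpull : ∀ᶠ ζ in 𝓝 η, ∀ a b, g.pullback L.symm ζ a b =
      g.pullback (extChartAt (𝓡 d) y).symm (θ ζ) (fderiv ℝ θ ζ a) (fderiv ℝ θ ζ b) := by
    filter_upwards [hev.eventually_nhds] with ζ hζ a b
    obtain ⟨h1, h2⟩ := hζ.self_of_nhds
    refine g.pullback_comp ?_ ((hθev ζ h1 h2).differentiableAt (by simp)) ?_ a b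
    · exact ((contMDiffOn_extChartAt_symm (n := ∞) y).contMDiffAt
        ((isOpen_extChartAt_target y).mem_nhds ((extChartAt (𝓡 d) y).map_source h2))
        ).mdifferentiableAt (by simp)
    · filter_upwards [hζ] with ζ' h'
      exact ((extChartAt (𝓡 d) y).left_inv h'.2).symm
  have hyθ : θ η ∈ (extChartAt (𝓡 d) y).target := mem_extChartAt_target y
  have := euler_lagrange_comp (B := g.pullback (extChartAt (𝓡 d) y).symm)
    (G := g.pullback L.symm) (θ := θ) (t := 1) (ξ := η) (v := v)
    (by rw [one_smul]; exact (hθev η hη (mem_extChartAt_source y)).of_le (WithTop.coe_le_coe.2 le_top))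
    (by rw [one_smul]; exact g.differentiableAt_pullback (isOpen_extChartAt_target y)
          (contMDiffOn_extChartAt_symm y) hyθ)
    (fun a b ↦ g.pullback_symm _ _ _ _)
    (by rw [one_smul]; exact hpull)
    (by rw [one_smul]; exact g.differentiableAt_pullback L.open_target hL.smooth_symm hη)
    (by
      rw [one_smul]
      have h1 := hgeo (fderiv ℝ θ η v)
      have h2 : (fun s : ℝ ↦ θ (s • η)) 1 = θ η := congrArg θ (one_smul ℝ η)
      simp only [one_smul] at h2 h1
      exact h1)
  simpa only [one_smul] using this

/-- The velocity condition gives this only for vectors in the target. The target is a neighbourhood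
of 0, so it contains a nonzero multiple of any v, and linearity does the rest. -/
theorem mfderiv_symm_zero (hL : g.IsExpInverse U x L) (hx : x ∈ U)
    (v : EuclideanSpace ℝ (Fin d)) :
    (mfderiv 𝓘(ℝ, EuclideanSpace ℝ (Fin d)) (𝓡 d) L.symm 0 :
      EuclideanSpace ℝ (Fin d) →L[ℝ] EuclideanSpace ℝ (Fin d)) v = v := by
  have h0 := hL.zero_mem_target hx
  have hd : MDifferentiableAt 𝓘(ℝ, EuclideanSpace ℝ (Fin d)) (𝓡 d) L.symm 0 :=
    ((hL.smooth_symm 0 h0).contMDiffAt (L.open_target.mem_nhds h0)).mdifferentiableAt (by simp)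
  have hT : ∀ ξ ∈ L.target, (mfderiv 𝓘(ℝ, EuclideanSpace ℝ (Fin d)) (𝓡 d) L.symm 0 :
      EuclideanSpace ℝ (Fin d) →L[ℝ] EuclideanSpace ℝ (Fin d)) ξ = ξ := by
    intro ξ hξ
    have hline : HasFDerivAt (fun s : ℝ ↦ s • ξ)
        (ContinuousLinearMap.toSpanSingleton ℝ ξ) (0 : ℝ) := by
      simpa using! (ContinuousLinearMap.toSpanSingleton ℝ ξ).hasFDerivAt (x := (0 : ℝ))
    have hd' : HasMFDerivAt 𝓘(ℝ, EuclideanSpace ℝ (Fin d)) (𝓡 d) L.symm ((0 : ℝ) • ξ)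
        (mfderiv 𝓘(ℝ, EuclideanSpace ℝ (Fin d)) (𝓡 d) L.symm ((0 : ℝ) • ξ)) := by
      apply MDifferentiableAt.hasMFDerivAt
      rw [zero_smul]
      exact hd
    have h1 := (HasMFDerivAt.comp (0 : ℝ) hd' hline.hasMFDerivAt).mfderiv
    have h2 := hL.velocity ξ hξ
    have h3 := (DFunLike.congr_fun h1 (1 : ℝ)).symm.trans h2
    have h4 : (mfderiv 𝓘(ℝ, EuclideanSpace ℝ (Fin d)) (𝓡 d) L.symm ((0 : ℝ) • ξ) :
      EuclideanSpace ℝ (Fin d) →L[ℝ] EuclideanSpace ℝ (Fin d)) ((1 : ℝ) • ξ) = ξ := h3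
    have h5 : ∀ p : EuclideanSpace ℝ (Fin d), p = 0 →
        (mfderiv 𝓘(ℝ, EuclideanSpace ℝ (Fin d)) (𝓡 d) L.symm p :
        EuclideanSpace ℝ (Fin d) →L[ℝ] EuclideanSpace ℝ (Fin d)) ξ = ξ →
        (mfderiv 𝓘(ℝ, EuclideanSpace ℝ (Fin d)) (𝓡 d) L.symm 0 :
        EuclideanSpace ℝ (Fin d) →L[ℝ] EuclideanSpace ℝ (Fin d)) ξ = ξ := by
      rintro p rfl h
      exact h
    rw [one_smul] at h4
    exact h5 _ (zero_smul ℝ ξ) h4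
  have hev : ∀ᶠ t : ℝ in 𝓝[≠] 0, t • v ∈ L.target := by
    have : Tendsto (fun t : ℝ ↦ t • v) (𝓝 0) (𝓝 0) := by
      simpa using! (continuous_id.smul continuous_const).tendsto (0 : ℝ) (f := fun t : ℝ ↦ t • v)
    exact (this.eventually (L.open_target.mem_nhds h0)).filter_mono nhdsWithin_le_nhds
  obtain ⟨t, ht, ht0⟩ := (hev.and self_mem_nhdsWithin).exists
  have := hT _ ht
  exact smul_right_injective _ ht0 ((ContinuousLinearMap.map_smul
    (mfderiv 𝓘(ℝ, EuclideanSpace ℝ (Fin d)) (𝓡 d) L.symm 0 :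
      EuclideanSpace ℝ (Fin d) →L[ℝ] EuclideanSpace ℝ (Fin d)) t v).symm.trans this)

/-- The Gauss lemma. -/
theorem gauss (hL : g.IsExpInverse U x L) (hx : x ∈ U) {η : EuclideanSpace ℝ (Fin d)}
    (hη : η ∈ L.target) (v : EuclideanSpace ℝ (Fin d)) :
    g.pullback L.symm η η v = g.inner x η v := by
  have h0 := hL.zero_mem_target hx
  rw [gauss_of_euler_lagrange L.open_target hL.starConvex
    (fun η hη ↦ g.differentiableAt_pullback L.open_target hL.smooth_symm hη)
    (fun η _ ↦ g.pullback_symm _ _) (fun η hη v ↦ hL.euler_lagrange hη v) hη v]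
  have hinner : ∀ y y' : M, y = y' → ∀ a b : EuclideanSpace ℝ (Fin d),
      g.inner y a b = g.inner y' a b := by rintro y _ rfl a b; rfl
  have hx0 : L.symm 0 = x := by
    rw [← hL.map_base]
    exact L.left_inv (hL.source_eq ▸ hx)
  rw [← hinner _ _ hx0]
  exact congrArg₂ (fun a b : EuclideanSpace ℝ (Fin d) ↦ g.inner (L.symm 0) a b)
    (hL.mfderiv_symm_zero hx η) (hL.mfderiv_symm_zero hx v)

end IsExpInverse
end LorentzMetric
end NormalCoordinates


/-! ### The gradient of the quadratic distance function -/

section DistanceFunction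

variable {d : ℕ} {M : Type*} [TopologicalSpace M] [ChartedSpace (EuclideanSpace ℝ (Fin d)) M]
  [IsManifold (𝓡 d) ∞ M]

theorem mvfderiv_congr_of_eventuallyEq {f f' : M → ℝ} {y : M} (h : f =ᶠ[𝓝 y] f')
    (v : TangentSpace (𝓡 d) y) : mvfderiv (𝓡 d) f y v = mvfderiv (𝓡 d) f' y v :=
  DFunLike.congr_fun (h.mfderiv_eq (I := 𝓡 d) (I' := 𝓘(ℝ, ℝ))) v

namespace LorentzMetric

variable (g : LorentzMetric d M)

theorem inner_grad (f : M → ℝ) (y : M) (w : TangentSpace (𝓡 d) y) :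
    g.inner y (g.grad f y) w = mvfderiv (𝓡 d) f y w :=
  (g.exists_representative y (mvfderiv (𝓡 d) f y)).choose_spec w

variable {g} in
theorem grad_eq_of_inner {f : M → ℝ} {y : M} {u : TangentSpace (𝓡 d) y}
    (h : ∀ w, g.inner y u w = mvfderiv (𝓡 d) f y w) : g.grad f y = u := by
  rw [← sub_eq_zero]
  refine g.nondegenerate y _ fun w ↦ ?_
  rw [map_sub, sub_apply, g.inner_grad, h, sub_self]

theorem grad_congr {f f' : M → ℝ} {y : M} (h : f =ᶠ[𝓝 y] f') : g.grad f y = g.grad f' y :=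
  grad_eq_of_inner fun w ↦ by rw [g.inner_grad, mvfderiv_congr_of_eventuallyEq h]

/-- Two derivatives are taken, so the coordinate expressions must have equal germs at all nearby
points, not only at the image of y. -/
theorem dAlembert_congr {f f' : M → ℝ} {y : M} (h : f =ᶠ[𝓝 y] f') :
    g.dAlembert f y = g.dAlembert f' y := by
  have h1 : ∀ᶠ p in 𝓝 (extChartAt (𝓡 d) y y),
      (f ∘ (extChartAt (𝓡 d) y).symm) =ᶠ[𝓝 p] (f' ∘ (extChartAt (𝓡 d) y).symm) := by
    apply eventually_eventually_nhds.2
    have hc : Tendsto (extChartAt (𝓡 d) y).symm (𝓝 (extChartAt (𝓡 d) y y)) (𝓝 y) := by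
      simpa using! (continuousAt_extChartAt_symm (I := 𝓡 d) y).tendsto
    exact hc.eventually h
  unfold dAlembert
  congr 2
  refine Finset.sum_congr rfl fun i _ ↦ Finset.sum_congr rfl fun j _ ↦ ?_
  refine DFunLike.congr_fun (Filter.EventuallyEq.fderiv_eq (𝕜 := ℝ) ?_)
    (EuclideanSpace.single i (1 : ℝ))
  filter_upwards [h1] with p hp
  unfold partialDeriv
  rw [hp.fderiv_eq]

variable {g} {U : Set M} {x : M} {L : OpenPartialHomeomorph M (EuclideanSpace ℝ (Fin d))}

namespace IsExpInverse

theorem isOpen (hL : g.IsExpInverse U x L) : IsOpen U := hL.source_eq ▸ L.open_source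

theorem contMDiffAt (hL : g.IsExpInverse U x L) {y : M} (hy : y ∈ U) :
    ContMDiffAt (𝓡 d) 𝓘(ℝ, EuclideanSpace ℝ (Fin d)) ∞ L y :=
  (hL.smooth y hy).contMDiffAt (hL.isOpen.mem_nhds hy)

theorem contMDiffAt_symm (hL : g.IsExpInverse U x L) {η : EuclideanSpace ℝ (Fin d)}
    (hη : η ∈ L.target) : ContMDiffAt 𝓘(ℝ, EuclideanSpace ℝ (Fin d)) (𝓡 d) ∞ L.symm η :=
  (hL.smooth_symm η hη).contMDiffAt (L.open_target.mem_nhds hη)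

theorem contMDiffAt_neg_inner (hL : g.IsExpInverse U x L) {y : M} (hy : y ∈ U) :
    ContMDiffAt (𝓡 d) 𝓘(ℝ, ℝ) ∞ (fun y ↦ -g.inner x (L y) (L y)) y := by
  let B : EuclideanSpace ℝ (Fin d) →L[ℝ] EuclideanSpace ℝ (Fin d) →L[ℝ] ℝ := g.inner x
  have h : ContDiff ℝ ∞ (fun η ↦ -B η η) :=
    (B.contDiff.clm_apply contDiff_id).neg
  exact h.contDiffAt.contMDiffAt.comp y (hL.contMDiffAt hy)

/-- The gradient of the quadratic distance function is radial. -/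
theorem grad_neg_inner (hL : g.IsExpInverse U x L) (hx : x ∈ U) {η : EuclideanSpace ℝ (Fin d)}
    (hη : η ∈ L.target) :
    g.grad (fun y ↦ -g.inner x (L y) (L y)) (L.symm η) =
      (-2 : ℝ) • mfderiv 𝓘(ℝ, EuclideanSpace ℝ (Fin d)) (𝓡 d) L.symm η η := by
  let B : EuclideanSpace ℝ (Fin d) →L[ℝ] EuclideanSpace ℝ (Fin d) →L[ℝ] ℝ := g.inner x
  have hB : ∀ a b, B a b = B b a := g.symm x
  have hy := hL.symm_mem hη
  set y := L.symm η with hydef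
  have hLy : L y = η := L.right_inv hη
  apply grad_eq_of_inner
  intro w
  have hLd : HasMFDerivAt (𝓡 d) 𝓘(ℝ, EuclideanSpace ℝ (Fin d)) L y _ :=
    ((hL.contMDiffAt hy).mdifferentiableAt (by simp)).hasMFDerivAt
  have hsd : HasMFDerivAt 𝓘(ℝ, EuclideanSpace ℝ (Fin d)) (𝓡 d) L.symm (L y)
      (mfderiv 𝓘(ℝ, EuclideanSpace ℝ (Fin d)) (𝓡 d) L.symm (L y)) := by
    rw [hLy]
    exact ((hL.contMDiffAt_symm hη).mdifferentiableAt (by simp)).hasMFDerivAt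
  set v : EuclideanSpace ℝ (Fin d) :=
    mfderiv (𝓡 d) 𝓘(ℝ, EuclideanSpace ℝ (Fin d)) L y w with hv
  -- Every tangent vector w at y is the image of v = DL(w), so the Gauss lemma, stated in
  -- exponential coordinates, can be tested against it.
  have hinv : (mfderiv 𝓘(ℝ, EuclideanSpace ℝ (Fin d)) (𝓡 d) L.symm η :
      EuclideanSpace ℝ (Fin d) →L[ℝ] EuclideanSpace ℝ (Fin d)) v = w := by
    have h1 := (HasMFDerivAt.comp y hsd hLd).congr_of_eventuallyEq (f₁ := id)
      (by filter_upwards [hL.isOpen.mem_nhds hy] with y' hy'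
          exact (L.left_inv (hL.source_eq ▸ hy')).symm)
    have h2 := hasMFDerivAt_unique h1 (hasMFDerivAt_id y)
    have h3 : (mfderiv 𝓘(ℝ, EuclideanSpace ℝ (Fin d)) (𝓡 d) L.symm (L y) :
      EuclideanSpace ℝ (Fin d) →L[ℝ] EuclideanSpace ℝ (Fin d)) v = w := DFunLike.congr_fun h2 w
    rwa [hLy] at h3
  have hder : mvfderiv (𝓡 d) (fun y ↦ -B (L y) (L y)) y w = -(2 * B η v) := by
    have h1 : HasFDerivAt (fun η ↦ -B η η) _ (L y) :=
      ((B.hasFDerivAt (x := L y)).clm_apply (hasFDerivAt_id (L y))).neg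
    have h2 := (HasMFDerivAt.comp y h1.hasMFDerivAt hLd).mfderiv
    have h3 := DFunLike.congr_fun h2 w
    refine h3.trans ?_
    change -(B (L y) v + B v (L y)) = _
    rw [hLy, hB v]
    ring
  refine Eq.trans ?_ hder.symm
  have hg := hL.gauss hx hη v
  rw [pullback_apply] at hg
  have hB' : g.inner x η v = B η v := rfl
  rw [hB'] at hg
  rw [← hg]
  have e : ∀ a b : EuclideanSpace ℝ (Fin d), g.inner y ((-2 : ℝ) • a) b = -(2 * g.inner y a b) := by
    intro a b
    let C : EuclideanSpace ℝ (Fin d) →L[ℝ] EuclideanSpace ℝ (Fin d) →L[ℝ] ℝ := g.inner y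
    change C ((-2 : ℝ) • a) b = -(2 * C a b)
    simp
  exact (e _ w).trans (by rw [← hinv])

end IsExpInverse

/-- `Gam` rests on a choice of inverse exponential map. Later arguments work with this chosen `L`,
so its uniqueness does not have to be proved. -/
theorem exists_isExpInverse_gam (h : ∃ L, g.IsExpInverse U x L) :
    ∃ L, g.IsExpInverse U x L ∧ (fun y ↦ g.Gam U y x) = fun y ↦ -g.inner x (L y) (L y) := by
  refine ⟨h.choose, h.choose_spec, ?_⟩
  funext y
  simp [Gam, h]

/-- The derivative of a function along a radial geodesic in terms of the gradient of a function
that agrees with `Γ` nearby. -/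
theorem IsExpInverse.hasDerivAt_radial (hL : g.IsExpInverse U x L) (hx : x ∈ U)
    {ξ : EuclideanSpace ℝ (Fin d)} {t : ℝ} (ht : t • ξ ∈ L.target) {f a : M → ℝ}
    (hf : f =ᶠ[𝓝 (L.symm (t • ξ))] fun y ↦ -g.inner x (L y) (L y))
    (ha : MDifferentiableAt (𝓡 d) 𝓘(ℝ, ℝ) a (L.symm (t • ξ))) :
    ∃ a' : ℝ, HasDerivAt (fun t : ℝ ↦ a (L.symm (t • ξ))) a' t ∧
      mvfderiv (𝓡 d) a (L.symm (t • ξ)) (g.grad f (L.symm (t • ξ))) = -2 * t * a' := by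
  have hline : HasDerivAt (fun s : ℝ ↦ s • ξ) ξ t := by
    simpa using (hasDerivAt_id t).smul_const ξ
  have hs := ((hL.contMDiffAt_symm ht).mdifferentiableAt (by simp)).hasMFDerivAt
  have hc := HasMFDerivAt.comp (t • ξ) ha.hasMFDerivAt hs
  have hF : HasFDerivAt (a ∘ L.symm) (_ : EuclideanSpace ℝ (Fin d) →L[ℝ] ℝ) (t • ξ) :=
    hasMFDerivAt_iff_hasFDerivAt.1 hc
  refine ⟨_, HasFDerivAt.comp_hasDerivAt (l := a ∘ L.symm) t hF hline, ?_⟩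
  rw [g.grad_congr hf, hL.grad_neg_inner hx ht]
  set A : EuclideanSpace ℝ (Fin d) →L[ℝ] ℝ := mvfderiv (𝓡 d) a (L.symm (t • ξ)) with hA
  set D : EuclideanSpace ℝ (Fin d) →L[ℝ] EuclideanSpace ℝ (Fin d) :=
    mfderiv 𝓘(ℝ, EuclideanSpace ℝ (Fin d)) (𝓡 d) L.symm (t • ξ) with hD
  change A ((-2 : ℝ) • D (t • ξ)) = -2 * t * A (D ξ)
  simp only [map_smul, smul_eq_mul]
  ring

end LorentzMetric
end DistanceFunction


/-! ### The transport operator as a commutator; locality -/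

section TransportOperator

variable {d : ℕ} {M : Type*} [TopologicalSpace M] [T2Space M]
  [ChartedSpace (EuclideanSpace ℝ (Fin d)) M] [IsManifold (𝓡 d) ∞ M]
  {g : LorentzMetric d M}
  {F : Type*} [NormedAddCommGroup F] [NormedSpace ℂ F]
  {E : M → Type*} [TopologicalSpace (TotalSpace F E)]
  [∀ x, AddCommGroup (E x)] [∀ x, Module ℂ (E x)] [∀ x, TopologicalSpace (E x)]
  [FiberBundle F E] [VectorBundle ℂ F E] [VectorBundle ℝ F E]

/-- A function that is smooth near `y` has the germ of a globally smooth function. -/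
theorem exists_smooth_function_germ {f : M → ℝ} {y : M}
    (hf : ∀ᶠ x in 𝓝 y, ContMDiffAt (𝓡 d) 𝓘(ℝ, ℝ) ∞ f x) :
    ∃ f' : C^∞⟮𝓡 d, M; ℝ⟯, ∀ᶠ x in 𝓝 y, f' x = f x := by
  obtain ⟨b, hb, -⟩ := (SmoothBumpFunction.nhds_basis_support (I := 𝓡 d) hf).mem_iff.1 hf
  refine ⟨⟨fun x ↦ b x • f x, contMDiff_of_tsupport fun x hx ↦ ?_⟩, ?_⟩
  · exact b.contMDiffAt.smul (hb (closure_mono (Function.support_smul_subset_left _ _) hx))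
  · filter_upwards [b.eventuallyEq_one] with x hx
    change b x • f x = f x
    simp [hx]

/-- A section that is smooth near `y` has the germ of a globally smooth section. -/
theorem exists_smooth_section_germ {s : ∀ x, E x} {y : M}
    (hs : ∀ᶠ x in 𝓝 y, ContMDiffAt (𝓡 d) ((𝓡 d).prod 𝓘(ℝ, F)) ∞
      (fun x ↦ TotalSpace.mk' F x (s x)) x) :
    ∃ t : SmoothSections d F E, ∀ᶠ x in 𝓝 y, t.1 x = s x := by
  obtain ⟨b, hb, -⟩ := (SmoothBumpFunction.nhds_basis_support (I := 𝓡 d) hs).mem_iff.1 hs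
  refine ⟨⟨fun x ↦ b x • s x, fun x ↦ ?_⟩, ?_⟩
  · by_cases hx : x ∈ tsupport b
    · exact ContMDiffAt.smul_section b.contMDiffAt (hb hx)
    · refine (Bundle.contMDiff_zeroSection ℝ E).contMDiffAt.congr_of_eventuallyEq ?_
      filter_upwards [(isClosed_tsupport b).isOpen_compl.mem_nhds hx] with x' hx'
      simp [image_eq_zero_of_notMem_tsupport hx', zeroSection]
  · filter_upwards [b.eventuallyEq_one] with x hx
    simp [hx]

/-- The first order operator `- 1/2 [P, f] + d`. It is the transport operator
`∇_{grad f} - (1/2 □ f - d)` of the connection induced by `P`. -/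
def commutatorOp (P : Module.End ℂ (SmoothSections d F E)) (f : C^∞⟮𝓡 d, M; ℝ⟯) :
    Module.End ℂ (SmoothSections d F E) :=
  (((-(1 / 2) : ℝ) : ℂ)) • (P * mulFun F E f - mulFun F E f * P) +
    ((d : ℝ) : ℂ) • (1 : Module.End ℂ (SmoothSections d F E))

theorem commutatorOp_apply (P : Module.End ℂ (SmoothSections d F E)) (f : C^∞⟮𝓡 d, M; ℝ⟯)
    (s : SmoothSections d F E) (y : M) :
    (commutatorOp P f s).1 y = (-(1 / 2) : ℝ) • ((P (mulFun F E f s)).1 y - f y • (P s).1 y) +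
      (d : ℝ) • s.1 y := by
  rw [← Complex.coe_smul, ← Complex.coe_smul]
  rfl

theorem mulFun_apply (f : C^∞⟮𝓡 d, M; ℝ⟯) (s : SmoothSections d F E) (y : M) :
    (mulFun F E f s).1 y = f y • s.1 y := rfl

theorem coe_sum_apply {ι : Type*} (I : Finset ι) (s : ι → SmoothSections d F E) (y : M) :
    (∑ i ∈ I, s i).1 y = ∑ i ∈ I, (s i).1 y := by
  rw [AddSubmonoidClass.coe_finsetSum, Finset.sum_apply]

variable [∀ x, IsTopologicalAddGroup (E x)] [∀ x, ContinuousSMul ℂ (E x)]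

variable (g) in
/-- The transport operator `∇_{grad φ} - (1/2 □ φ - d)`. -/
def transport (φ : M → ℝ) (nabla : CovariantDerivative (𝓡 d) F E) (s : ∀ x, E x) (y : M) : E y :=
  nabla s y (g.grad φ y) - (1 / 2 * g.dAlembert φ y - d) • s y

variable {P : Module.End ℂ (SmoothSections d F E)} {nabla : CovariantDerivative (𝓡 d) F E}

theorem mdifferentiableAt_smoothSection (t : SmoothSections d F E) (y : M) :
    MDifferentiableAt (𝓡 d) ((𝓡 d).prod 𝓘(ℝ, F)) (fun x ↦ TotalSpace.mk' F x (t.1 x)) y :=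
  ContMDiffAt.mdifferentiableAt (t.2 y) (by simp)

theorem nabla_congr {s : ∀ x, E x} {t : SmoothSections d F E} {y : M}
    (hst : ∀ᶠ x in 𝓝 y, t.1 x = s x) : nabla s y = nabla t.1 y := by
  have hs : MDifferentiableAt (𝓡 d) ((𝓡 d).prod 𝓘(ℝ, F)) (fun x ↦ TotalSpace.mk' F x (s x)) y :=
    (mdifferentiableAt_smoothSection t y).congr_of_eventuallyEq (hst.mono fun x hx ↦ by simp [hx])
  exact nabla.isCovariantDerivativeOnUniv.congr_of_eventuallyEq hs (mdifferentiableAt_smoothSection t y)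
    univ_mem (hst.mono fun x hx ↦ hx.symm)

/-- Solving the Leibniz rule of the induced connection for ∇ leaves an expression in `P` alone.
Hence ρ is ℂ-linear on germs, and any two connections induced by `P` give the same ρ. -/
theorem IsInducedConnection.transport_eq (h : IsInducedConnection g P nabla) {φ : M → ℝ}
    {f : C^∞⟮𝓡 d, M; ℝ⟯} {s : ∀ x, E x} {t : SmoothSections d F E} {y : M}
    (hf : ∀ᶠ x in 𝓝 y, f x = φ x) (hst : ∀ᶠ x in 𝓝 y, t.1 x = s x) :
    transport g φ nabla s y = (commutatorOp P f t).1 y := by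
  have hf' : (f : M → ℝ) =ᶠ[𝓝 y] φ := hf
  rw [transport, commutatorOp_apply, h.2, nabla_congr hst, ← hst.self_of_nhds,
    ← g.grad_congr hf', ← g.dAlembert_congr hf']
  module

/-- An operator that induces a connection is local. -/
theorem IsInducedConnection.apply_congr (h : IsInducedConnection g P nabla)
    {s t : SmoothSections d F E} {y : M} (hst : ∀ᶠ x in 𝓝 y, s.1 x = t.1 x) :
    (P s).1 y = (P t).1 y := by
  -- The bump f is 1 near y and supported where s = t, so f (s - t) = 0 globally. In the Leibniz
  -- rule at y the gradient term vanishes because f is locally constant, and the □ term because s -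
  -- t vanishes at y; only P (s - t) at y is left.
  obtain ⟨b, hb, -⟩ := (SmoothBumpFunction.nhds_basis_support (I := 𝓡 d) hst).mem_iff.1 hst
  let f : C^∞⟮𝓡 d, M; ℝ⟯ := ⟨b, b.contMDiff⟩
  have h1 : mulFun F E f (s - t) = 0 := by
    ext x
    change b x • (s.1 x - t.1 x) = 0
    by_cases hx : x ∈ tsupport b
    · have : s.1 x = t.1 x := hb hx
      rw [this, sub_self, smul_zero]
    · rw [image_eq_zero_of_notMem_tsupport hx, zero_smul]
  have hgrad : g.grad f y = 0 := by
    apply LorentzMetric.grad_eq_of_inner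
    intro w
    have hf : (f : M → ℝ) =ᶠ[𝓝 y] fun _ ↦ 1 := b.eventuallyEq_one
    rw [mvfderiv_congr_of_eventuallyEq hf, mvfderiv_const]
    simp
  have h2 := h.2 f (s - t) y
  have h3 : (s - t).1 y = 0 := sub_eq_zero.2 hst.self_of_nhds
  have h4 : f y = 1 := b.eq_one
  rw [h1, hgrad, h3, h4, map_zero, map_zero] at h2
  simp only [smul_zero, sub_zero, add_zero, one_smul, map_sub] at h2
  exact (sub_eq_zero.1 h2.symm)

/-- `applyLocal` picks an arbitrary global extension of the germ; by locality any other extension t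
gives the same value. -/
theorem IsInducedConnection.applyLocal_eq (h : IsInducedConnection g P nabla)
    {s : ∀ x, E x} {t : SmoothSections d F E} {y : M} (hst : ∀ᶠ x in 𝓝 y, t.1 x = s x) :
    applyLocal P s y = (P t).1 y := by
  have hex : ∃ t : SmoothSections d F E, ∀ᶠ x in 𝓝 y, t.1 x = s x := ⟨t, hst⟩
  rw [applyLocal, dif_pos hex]
  apply h.apply_congr
  filter_upwards [hex.choose_spec, hst] with x h1 h2
  rw [h1, h2]

/-- The transport operator is a derivation along the gradient. -/
theorem IsInducedConnection.commutatorOp_mulFun (h : IsInducedConnection g P nabla)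
    (f a : C^∞⟮𝓡 d, M; ℝ⟯) (s : SmoothSections d F E) (y : M) :
    (commutatorOp P f (mulFun F E a s)).1 y =
      a y • (commutatorOp P f s).1 y + mvfderiv (𝓡 d) a y (g.grad f y) • s.1 y := by
  have hrefl : ∀ t : SmoothSections d F E, ∀ᶠ x in 𝓝 y, t.1 x = t.1 x :=
    fun t ↦ Eventually.of_forall fun _ ↦ rfl
  rw [← h.transport_eq (Eventually.of_forall fun _ ↦ rfl) (hrefl (mulFun F E a s)),
    ← h.transport_eq (Eventually.of_forall fun _ ↦ rfl) (hrefl s), transport, transport]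
  have ha : MDifferentiableAt (𝓡 d) 𝓘(ℝ, ℝ) a y := (a.contMDiff y).mdifferentiableAt (by simp)
  have h1 := nabla.isCovariantDerivativeOnUniv.leibniz (mdifferentiableAt_smoothSection s y) ha
  have h2 : (mulFun F E a s).1 = (a : M → ℝ) • s.1 := rfl
  have h3 := DFunLike.congr_fun h1 (g.grad f y)
  rw [← h2] at h3
  have h4 : (mulFun F E a s).1 y = a y • s.1 y := rfl
  refine (congrArg (· - _) h3).trans ?_
  rw [h4]
  simp only [add_apply, ContinuousLinearMap.smulRight_apply, smul_apply]
  module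

end TransportOperator


/-! ### Smooth frames and the transport equation in components -/

section Frames

variable {d : ℕ} {M : Type*} [TopologicalSpace M] [T2Space M]
  [ChartedSpace (EuclideanSpace ℝ (Fin d)) M] [IsManifold (𝓡 d) ∞ M]
  {g : LorentzMetric d M}
  {F : Type*} [NormedAddCommGroup F] [NormedSpace ℂ F]
  {E : M → Type*} [TopologicalSpace (TotalSpace F E)]
  [∀ x, AddCommGroup (E x)] [∀ x, Module ℂ (E x)] [∀ x, TopologicalSpace (E x)]
  [FiberBundle F E] [VectorBundle ℂ F E] [VectorBundle ℝ F E]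
  [ContMDiffVectorBundle ∞ F E (𝓡 d)]

/-- A section that is smooth at `y` stays smooth in any trivialization around `y`. -/
theorem contMDiffAt_trivializationAt_snd {s : ∀ x, E x} {y₀ y : M}
    (hy : y ∈ (trivializationAt F E y₀).baseSet)
    (hs : ContMDiffAt (𝓡 d) ((𝓡 d).prod 𝓘(ℝ, F)) ∞ (fun x ↦ TotalSpace.mk' F x (s x)) y) :
    ContMDiffAt (𝓡 d) 𝓘(ℝ, F) ∞ (fun x ↦ (trivializationAt F E y₀ ⟨x, s x⟩).2) y :=
  ((trivializationAt F E y₀).contMDiffAt_section_iff (IB := 𝓡 d) (n := ∞) hy).1 hs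

variable [FiniteDimensional ℂ F]

/-- Smooth sections that form a basis of the fibre at `y₀` are a smooth frame near `y₀`. -/
theorem frame_near {ι : Type*} [Fintype ι] (s : ι → SmoothSections d F E) (y₀ : M)
    (b : Module.Basis ι ℝ (E y₀)) (hb : ∀ i, (s i).1 y₀ = b i) :
    (∀ᶠ y in 𝓝 y₀, LinearIndependent ℝ fun i ↦ (s i).1 y) ∧
    ∀ D : SmoothSections d F E, ∃ a : ι → C^∞⟮𝓡 d, M; ℝ⟯,
      ∀ᶠ y in 𝓝 y₀, D.1 y = ∑ i, a i y • (s i).1 y := by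
  -- Frames are taken over ℝ, since the Leibniz rules available for `P` and `nabla` concern real
  -- functions.
  have : FiniteDimensional ℝ F := FiniteDimensional.complexToReal F
  have : CompleteSpace F := FiniteDimensional.complete ℝ F
  set τ := trivializationAt F E y₀ with hτ
  have hy₀ : y₀ ∈ τ.baseSet := mem_baseSet_trivializationAt F E y₀
  have hbase : ∀ᶠ y in 𝓝 y₀, y ∈ τ.baseSet := τ.open_baseSet.mem_nhds hy₀
  -- Φ y sends coefficients c to the trivialized vector ∑ c_i s_i(y). It is invertible at y₀, hence
  -- nearby because isomorphisms form an open set; inverting it gives independence and smooth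
  -- coefficients at once.
  let Φ : M → (ι → ℝ) →L[ℝ] F := fun y ↦
    ∑ i, (ContinuousLinearMap.proj (R := ℝ) (φ := fun _ : ι ↦ ℝ) i).smulRight (τ ⟨y, (s i).1 y⟩).2
  have hΦapp : ∀ y (hy : y ∈ τ.baseSet) c,
      Φ y c = τ.continuousLinearEquivAt ℝ y hy (∑ i, c i • (s i).1 y) := by
    intro y hy c
    rw [map_sum]
    simp only [Φ, sum_apply, ContinuousLinearMap.smulRight_apply, map_smul]
    rfl
  have hΦs : ∀ᶠ y in 𝓝 y₀, ContMDiffAt (𝓡 d) 𝓘(ℝ, (ι → ℝ) →L[ℝ] F) ∞ Φ y := by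
    filter_upwards [hbase] with y hy
    have h1 : ∀ i, ContMDiffAt (𝓡 d) 𝓘(ℝ, (ι → ℝ) →L[ℝ] F) ∞ (fun y ↦
        (ContinuousLinearMap.proj (R := ℝ) (φ := fun _ : ι ↦ ℝ) i).smulRight
          (τ ⟨y, (s i).1 y⟩).2) y := fun i ↦ by
      have h2 := contMDiffAt_trivializationAt_snd hy ((s i).2 y)
      exact ((ContinuousLinearMap.smulRightL ℝ (ι → ℝ) F
        (ContinuousLinearMap.proj (R := ℝ) (φ := fun _ : ι ↦ ℝ) i)).contDiff.contDiffAt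
          ).contMDiffAt.comp y h2
    have h3 := ContMDiffAt.sum (t := Finset.univ) (fun i _ ↦ h1 i)
    refine h3.congr_of_eventuallyEq (Eventually.of_forall fun y ↦ ?_)
    simp [Φ]
  let e₀ : (ι → ℝ) ≃L[ℝ] F :=
    (b.equivFun.symm.trans (τ.continuousLinearEquivAt ℝ y₀ hy₀).toLinearEquiv).toContinuousLinearEquiv
  have he₀ : Φ y₀ = e₀ := by
    ext1 c
    rw [hΦapp y₀ hy₀]
    change _ = (τ.continuousLinearEquivAt ℝ y₀ hy₀) (b.equivFun.symm c)
    rw [b.equivFun_symm_apply]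
    simp_rw [hb]
  have heq : ∀ᶠ y in 𝓝 y₀, ∃ e : (ι → ℝ) ≃L[ℝ] F, (e : (ι → ℝ) →L[ℝ] F) = Φ y := by
    have h1 : ContinuousAt Φ y₀ := hΦs.self_of_nhds.continuousAt
    have h2 := e₀.nhds
    rw [← he₀] at h2
    exact h1.eventually h2
  have hlin : ∀ᶠ y in 𝓝 y₀, LinearIndependent ℝ fun i ↦ (s i).1 y := by
    filter_upwards [heq, hbase] with y ⟨e, he⟩ hy
    rw [Fintype.linearIndependent_iff]
    intro c hc
    have h1 : e c = 0 := by
      have : (e : (ι → ℝ) →L[ℝ] F) c = 0 := by rw [he, hΦapp y hy, hc, map_zero]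
      exact this
    have h2 : c = 0 := by simpa using h1
    exact fun i ↦ congrFun h2 i
  refine ⟨hlin, fun D ↦ ?_⟩
  let c : M → ι → ℝ := fun y ↦ (Φ y).inverse (τ ⟨y, D.1 y⟩).2
  have hc : ∀ᶠ y in 𝓝 y₀, ContMDiffAt (𝓡 d) 𝓘(ℝ, ι → ℝ) ∞ c y := by
    filter_upwards [heq, hbase, hΦs] with y ⟨e, he⟩ hy hΦy
    have h1 : ContDiffAt ℝ ∞ ContinuousLinearMap.inverse (Φ y) := he ▸ contDiffAt_map_inverse e
    exact (h1.contMDiffAt.comp y hΦy).clm_apply (contMDiffAt_trivializationAt_snd hy (D.2 y))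
  have hci : ∀ i, ∃ a : C^∞⟮𝓡 d, M; ℝ⟯, ∀ᶠ y in 𝓝 y₀, a y = c y i := fun i ↦
    exists_smooth_function_germ (hc.mono fun y hy ↦ contMDiffAt_pi_space.1 hy i)
  choose a ha using hci
  refine ⟨a, ?_⟩
  filter_upwards [heq, hbase, eventually_all.2 ha] with y ⟨e, he⟩ hy hay
  simp_rw [hay]
  apply (τ.continuousLinearEquivAt ℝ y hy).injective
  rw [← hΦapp y hy]
  have h1 : c y = e.symm (τ ⟨y, D.1 y⟩).2 := by
    change (Φ y).inverse _ = _
    rw [← he, ContinuousLinearMap.inverse_equiv]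
    rfl
  rw [← he, h1]
  exact (e.apply_symm_apply _).symm

variable [∀ x, IsTopologicalAddGroup (E x)] [∀ x, ContinuousSMul ℂ (E x)]
  {P : Module.End ℂ (SmoothSections d F E)} {nabla : CovariantDerivative (𝓡 d) F E}

/-- The transport equation in a smooth frame. -/
theorem IsInducedConnection.transport_frame (h : IsInducedConnection g P nabla)
    {ι : Type*} [Fintype ι] {s : ι → SmoothSections d F E} {y₀ : M} {φ : M → ℝ}
    {f : C^∞⟮𝓡 d, M; ℝ⟯} (hf : ∀ᶠ y in 𝓝 y₀, f y = φ y) {D : ∀ y, E y}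
    {a : ι → C^∞⟮𝓡 d, M; ℝ⟯} {N : ι → ι → C^∞⟮𝓡 d, M; ℝ⟯} {k : ℕ}
    (hlin : ∀ᶠ y in 𝓝 y₀, LinearIndependent ℝ fun i ↦ (s i).1 y)
    (ha : ∀ᶠ y in 𝓝 y₀, D y = ∑ i, a i y • (s i).1 y)
    (hN : ∀ i, ∀ᶠ y in 𝓝 y₀, (commutatorOp P f (s i)).1 y = ∑ j, N i j y • (s j).1 y)
    (hD : ∀ᶠ y in 𝓝 y₀, transport g φ nabla D y = (2 * k : ℝ) • D y) :
    ∀ᶠ y in 𝓝 y₀, ∀ j, mvfderiv (𝓡 d) (a j) y (g.grad f y) =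
      2 * k * a j y - ∑ i, a i y * N i j y := by
  filter_upwards [hf.eventually_nhds, ha.eventually_nhds, hlin, eventually_all.2 hN, hD]
    with y hfy hay hliny hNy hDy
  have h1 : ∀ᶠ x in 𝓝 y, (∑ i, mulFun F E (a i) (s i)).1 x = D x := by
    filter_upwards [hay] with x hx
    rw [coe_sum_apply, hx]
    rfl
  rw [h.transport_eq hfy h1, map_sum, coe_sum_apply, hay.self_of_nhds] at hDy
  simp_rw [h.commutatorOp_mulFun, hNy] at hDy
  have h2 : ∑ j, (mvfderiv (𝓡 d) (a j) y (g.grad f y) -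
      (2 * k * a j y - ∑ i, a i y * N i j y)) • (s j).1 y = 0 := by
    have h3 : ∑ i, a i y • ∑ j, N i j y • (s j).1 y = ∑ j, (∑ i, a i y * N i j y) • (s j).1 y := by
      simp_rw [Finset.smul_sum, Finset.sum_smul, mul_smul]
      exact Finset.sum_comm
    rw [Finset.sum_add_distrib, h3, Finset.smul_sum] at hDy
    simp_rw [sub_smul, Finset.sum_sub_distrib, mul_smul _ (a _ y)]
    simp_rw [mul_smul] at hDy ⊢
    rw [← hDy]
    abel
  intro j
  exact sub_eq_zero.1 (Fintype.linearIndependent_iff.1 hliny _ h2 j)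

end Frames


/-! ### Uniqueness for the singular transport equation -/

section TransportUniqueness

variable {d : ℕ} {M : Type*} [TopologicalSpace M] [T2Space M]
  [ChartedSpace (EuclideanSpace ℝ (Fin d)) M] [IsManifold (𝓡 d) ∞ M]
  {g : LorentzMetric d M}
  {F : Type*} [NormedAddCommGroup F] [NormedSpace ℂ F]
  {E : M → Type*} [TopologicalSpace (TotalSpace F E)]
  [∀ x, AddCommGroup (E x)] [∀ x, Module ℂ (E x)] [∀ x, TopologicalSpace (E x)]
  [FiberBundle F E] [VectorBundle ℂ F E] [VectorBundle ℝ F E]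
  [ContMDiffVectorBundle ∞ F E (𝓡 d)]

/-- Trivializations detect zeros, and being nonzero is an open condition on the trivialized section.
This makes the zero set along a geodesic closed in the connectedness argument. -/
theorem eventually_section_ne_zero {D : ∀ y, E y} {y₀ : M}
    (hD : ContMDiffAt (𝓡 d) ((𝓡 d).prod 𝓘(ℝ, F)) ∞ (fun y ↦ TotalSpace.mk' F y (D y)) y₀)
    (h0 : D y₀ ≠ 0) : ∀ᶠ y in 𝓝 y₀, D y ≠ 0 := by
  set τ := trivializationAt F E y₀ with hτ
  have hy₀ : y₀ ∈ τ.baseSet := mem_baseSet_trivializationAt F E y₀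
  have hzero : ∀ y, y ∈ τ.baseSet → ((τ ⟨y, D y⟩).2 = 0 ↔ D y = 0) := fun y hy ↦
    (τ.continuousLinearEquivAt ℝ y hy).map_eq_zero_iff
  have h1 := (contMDiffAt_trivializationAt_snd hy₀ hD).continuousAt.eventually_ne
    (mt (hzero y₀ hy₀).1 h0)
  filter_upwards [h1, τ.open_baseSet.mem_nhds hy₀] with y hy hyb
  exact mt (hzero y hyb).2 hy

/-- Near each point there are smooth sections that form a basis of the fibre there. -/
theorem exists_sections_basis [FiniteDimensional ℂ F] (y₀ : M) :
    ∃ (s : Fin (Module.finrank ℝ F) → SmoothSections d F E)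
      (b : Module.Basis (Fin (Module.finrank ℝ F)) ℝ (E y₀)), ∀ i, (s i).1 y₀ = b i := by
  have : FiniteDimensional ℝ F := FiniteDimensional.complexToReal F
  set τ := trivializationAt F E y₀ with hτ
  have hy₀ : y₀ ∈ τ.baseSet := mem_baseSet_trivializationAt F E y₀
  let b := Module.finBasis ℝ F
  have h : ∀ i, ∃ t : SmoothSections d F E, ∀ᶠ y in 𝓝 y₀, t.1 y = τ.localFrame b i y := fun i ↦
    exists_smooth_section_germ (by
      filter_upwards [τ.open_baseSet.mem_nhds hy₀] with y hy
      exact contMDiffAt_localFrame_of_mem (I := 𝓡 d) ∞ τ b i hy)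
  choose s hs using h
  exact ⟨s, τ.basisAt b hy₀, fun i ↦ by
    rw [(hs i).self_of_nhds, τ.localFrame_apply_of_mem_baseSet b hy₀]⟩

variable [FiniteDimensional ℂ F] [∀ x, IsTopologicalAddGroup (E x)] [∀ x, ContinuousSMul ℂ (E x)]
  {P : Module.End ℂ (SmoothSections d F E)} {nabla : CovariantDerivative (𝓡 d) F E}
  {U : Set M} {x : M} {L : OpenPartialHomeomorph M (EuclideanSpace ℝ (Fin d))}

theorem LorentzMetric.IsExpInverse.exists_germ (hL : g.IsExpInverse U x L) {y₀ : M}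
    (hy₀ : y₀ ∈ U) : ∃ f : C^∞⟮𝓡 d, M; ℝ⟯, ∀ᶠ y in 𝓝 y₀, f y = -g.inner x (L y) (L y) :=
  exists_smooth_function_germ (by
    filter_upwards [hL.isOpen.mem_nhds hy₀] with y hy using hL.contMDiffAt_neg_inner hy)

theorem OpenPartialHomeomorph.tendsto_symm_smul
    (L : OpenPartialHomeomorph M (EuclideanSpace ℝ (Fin d))) {ξ : EuclideanSpace ℝ (Fin d)} {t : ℝ} (ht : t • ξ ∈ L.target) :
    Tendsto (fun t : ℝ ↦ L.symm (t • ξ)) (𝓝 t) (𝓝 (L.symm (t • ξ))) :=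
  ContinuousAt.comp (f := fun t : ℝ ↦ t • ξ) (g := L.symm) (L.continuousAt_symm ht)
    (continuous_id.smul continuous_const).continuousAt

/-- The transport equation in a smooth frame along a radial geodesic. -/
theorem IsInducedConnection.transport_radial (h : IsInducedConnection g P nabla)
    (hL : g.IsExpInverse U x L) (hx : x ∈ U) {ξ : EuclideanSpace ℝ (Fin d)} {t₀ : ℝ}
    (ht₀ : t₀ • ξ ∈ L.target)
    {ι : Type*} [Fintype ι] {s : ι → SmoothSections d F E}
    {f : C^∞⟮𝓡 d, M; ℝ⟯} (hf : ∀ᶠ y in 𝓝 (L.symm (t₀ • ξ)), f y = -g.inner x (L y) (L y))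
    {D : ∀ y, E y} {a : ι → C^∞⟮𝓡 d, M; ℝ⟯} {N : ι → ι → C^∞⟮𝓡 d, M; ℝ⟯} {k : ℕ}
    (hlin : ∀ᶠ y in 𝓝 (L.symm (t₀ • ξ)), LinearIndependent ℝ fun i ↦ (s i).1 y)
    (ha : ∀ᶠ y in 𝓝 (L.symm (t₀ • ξ)), D y = ∑ i, a i y • (s i).1 y)
    (hN : ∀ i, ∀ᶠ y in 𝓝 (L.symm (t₀ • ξ)),
      (commutatorOp P f (s i)).1 y = ∑ j, N i j y • (s j).1 y)
    (hD : ∀ y ∈ U, transport g (fun y ↦ -g.inner x (L y) (L y)) nabla D y = (2 * k : ℝ) • D y) :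
    ∀ᶠ t in 𝓝 t₀, ∀ j, ∃ a' : ℝ, HasDerivAt (fun t : ℝ ↦ a j (L.symm (t • ξ))) a' t ∧
      -2 * t * a' = 2 * k * a j (L.symm (t • ξ)) -
        ∑ i, a i (L.symm (t • ξ)) * N i j (L.symm (t • ξ)) := by
  have hDU : ∀ᶠ y in 𝓝 (L.symm (t₀ • ξ)),
      transport g (fun y ↦ -g.inner x (L y) (L y)) nabla D y = (2 * k : ℝ) • D y := by
    filter_upwards [hL.isOpen.mem_nhds (hL.symm_mem ht₀)] with y hy using hD y hy
  have hfr := h.transport_frame hf hlin ha hN hDU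
  have htarget : ∀ᶠ t : ℝ in 𝓝 t₀, t • ξ ∈ L.target :=
    (continuous_id.smul continuous_const).continuousAt.eventually
      (f := fun t : ℝ ↦ t • ξ) (L.open_target.mem_nhds ht₀)
  filter_upwards [htarget, (L.tendsto_symm_smul ht₀).eventually hf.eventually_nhds,
    (L.tendsto_symm_smul ht₀).eventually hfr] with t ht hft hfrt j
  obtain ⟨a', h1, h2⟩ := hL.hasDerivAt_radial hx ht hft
    (((a j).contMDiff _).mdifferentiableAt (by simp))
  exact ⟨a', h1, by rw [← h2, hfrt j]⟩

/-- Away from the pole, the zeros of a solution of the transport equation propagate along radial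
geodesics. -/
theorem IsInducedConnection.eventually_eq_zero_of_ne (h : IsInducedConnection g P nabla)
    (hL : g.IsExpInverse U x L) (hx : x ∈ U) {ξ : EuclideanSpace ℝ (Fin d)} {t₀ : ℝ}
    (ht₀ : t₀ • ξ ∈ L.target) (hne : t₀ ≠ 0) {D : ∀ y, E y}
    (hDs : ∀ y ∈ U, ContMDiffAt (𝓡 d) ((𝓡 d).prod 𝓘(ℝ, F)) ∞
      (fun y ↦ TotalSpace.mk' F y (D y)) y) {k : ℕ}
    (hD : ∀ y ∈ U, transport g (fun y ↦ -g.inner x (L y) (L y)) nabla D y = (2 * k : ℝ) • D y)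
    (h0 : D (L.symm (t₀ • ξ)) = 0) : ∀ᶠ t in 𝓝 t₀, D (L.symm (t • ξ)) = 0 := by
  have hy₀ := hL.symm_mem ht₀
  set y₀ := L.symm (t₀ • ξ) with hy₀def
  obtain ⟨f, hf⟩ := hL.exists_germ hy₀
  obtain ⟨s, b, hb⟩ := exists_sections_basis (d := d) (F := F) (E := E) y₀
  obtain ⟨hlin, hframe⟩ := frame_near s y₀ b hb
  obtain ⟨D', hD'⟩ := exists_smooth_section_germ (s := D) (y := y₀) (by
    filter_upwards [hL.isOpen.mem_nhds hy₀] with y hy using hDs y hy)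
  obtain ⟨a, ha'⟩ := hframe D'
  have ha : ∀ᶠ y in 𝓝 y₀, D y = ∑ i, a i y • (s i).1 y := by
    filter_upwards [ha', hD'] with y h1 h2
    rw [← h2, h1]
  choose N hN using fun i ↦ hframe (commutatorOp P f (s i))
  have hode := h.transport_radial hL hx ht₀ hf hlin ha hN hD
  have hc := L.tendsto_symm_smul ht₀
  let c : ℝ → M := fun t ↦ L.symm (t • ξ)
  let u : ℝ → Fin (Module.finrank ℝ F) → ℝ := fun t j ↦ a j (c t)
  let S : Fin (Module.finrank ℝ F) → Fin (Module.finrank ℝ F) →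
      (Fin (Module.finrank ℝ F) → ℝ) →L[ℝ] (Fin (Module.finrank ℝ F) → ℝ) := fun i j ↦
    (ContinuousLinearMap.proj (R := ℝ) (φ := fun _ : Fin (Module.finrank ℝ F) ↦ ℝ) i).smulRight
      (Pi.single j (1 : ℝ))
  -- `S i j` are matrix units, and A is the coefficient matrix after dividing the frame equation by
  -- -2t, which is allowed near t₀ ≠ 0.
  let A : ℝ → (Fin (Module.finrank ℝ F) → ℝ) →L[ℝ] (Fin (Module.finrank ℝ F) → ℝ) := fun t ↦
    (-2 * t)⁻¹ • ((2 * k : ℝ) • ContinuousLinearMap.id ℝ _ - ∑ i, ∑ j, N i j (c t) • S i j)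
  have hAc : ContinuousAt A t₀ := by
    have hNc : ∀ i j, ContinuousAt (fun t ↦ N i j (c t)) t₀ := fun i j ↦
      ((N i j).contMDiff.continuous.continuousAt (x := y₀)).tendsto.comp hc
    have hS : ContinuousAt (fun t ↦ ∑ i, ∑ j, N i j (c t) • S i j) t₀ :=
      tendsto_finsetSum _ fun i _ ↦ tendsto_finsetSum _ fun j _ ↦
        (hNc i j).smul continuousAt_const
    have hinv : ContinuousAt (fun t : ℝ ↦ (-2 * t)⁻¹) t₀ :=
      (continuousAt_const.mul continuousAt_id).inv₀ (by simpa using hne)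
    exact hinv.smul (continuousAt_const.sub hS)
  have hu : ∀ᶠ t in 𝓝 t₀, HasDerivAt u (A t (u t)) t := by
    filter_upwards [hode, isOpen_ne.mem_nhds hne] with t ht htne
    rw [hasDerivAt_pi]
    intro j
    obtain ⟨a', h1, h2⟩ := ht j
    convert! h1 using 1
    have h3 : (∑ i, ∑ j, N i j (c t) • S i j) (u t) j = ∑ i, u t i * N i j (c t) := by
      simp only [sum_apply, smul_apply, Finset.sum_apply, S, ContinuousLinearMap.smulRight_apply,
        ContinuousLinearMap.proj_apply, Pi.smul_apply, smul_eq_mul, Pi.single_apply, mul_ite,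
        mul_one, mul_zero, Finset.sum_ite_eq, Finset.mem_univ, if_true]
      exact Finset.sum_congr rfl fun i _ ↦ mul_comm _ _
    have h4 : A t (u t) j = (-2 * t)⁻¹ * (2 * k * u t j - ∑ i, u t i * N i j (c t)) := by
      rw [← h3]
      rfl
    rw [h4]
    change (-2 * t)⁻¹ * (2 * k * a j (L.symm (t • ξ)) -
      ∑ i, a i (L.symm (t • ξ)) * N i j (L.symm (t • ξ))) = a'
    rw [← h2]
    have : -2 * t ≠ 0 := mul_ne_zero (by norm_num) htne
    exact inv_mul_cancel_left₀ this a'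
  have hu0 : u t₀ = 0 := by
    have h1 := ha.self_of_nhds
    rw [h0] at h1
    funext j
    exact Fintype.linearIndependent_iff.1 hlin.self_of_nhds _ h1.symm j
  filter_upwards [eventually_eq_zero_of_linear_ode hAc hu hu0, hc.eventually ha] with t ht hat
  rw [hat]
  refine Finset.sum_eq_zero fun i _ ↦ ?_
  rw [show a i (L.symm (t • ξ)) = 0 from congrFun ht i, zero_smul]

/-- Near the pole, a solution of `(ρ - 2 k) D = 0` vanishes, provided that `0 < k` or that it
vanishes at the pole. Here `W` is a frame of solutions of `ρ W = 0`. -/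
theorem IsInducedConnection.eventually_eq_zero_at_pole (h : IsInducedConnection g P nabla)
    (hL : g.IsExpInverse U x L) (hx : x ∈ U) (ξ : EuclideanSpace ℝ (Fin d))
    {W : ∀ y, E x →L[ℂ] E y}
    (hWs : ∀ e, ∀ y ∈ U, ContMDiffAt (𝓡 d) ((𝓡 d).prod 𝓘(ℝ, F)) ∞
      (fun y ↦ TotalSpace.mk' F y (W y e)) y)
    (hWx : W x = ContinuousLinearMap.id ℂ (E x))
    (hW : ∀ e, ∀ y ∈ U,
      transport g (fun y ↦ -g.inner x (L y) (L y)) nabla (fun y ↦ W y e) y = 0)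
    {D : ∀ y, E y}
    (hDs : ∀ y ∈ U, ContMDiffAt (𝓡 d) ((𝓡 d).prod 𝓘(ℝ, F)) ∞
      (fun y ↦ TotalSpace.mk' F y (D y)) y) {k : ℕ}
    (hD : ∀ y ∈ U, transport g (fun y ↦ -g.inner x (L y) (L y)) nabla D y = (2 * k : ℝ) • D y)
    (hk : k = 0 → D x = 0) : ∀ᶠ t : ℝ in 𝓝 0, 0 ≤ t → D (L.symm (t • ξ)) = 0 := by
  have ht₀ : (0 : ℝ) • ξ ∈ L.target := by
    rw [zero_smul]
    exact hL.zero_mem_target hx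
  have hpole : L.symm ((0 : ℝ) • ξ) = x := by
    rw [zero_smul, ← hL.map_base]
    exact L.left_inv (hL.source_eq ▸ hx)
  obtain ⟨f, hf⟩ := hL.exists_germ hx
  -- Only the basis of E_x is kept. The frame used is W y (b i), which equals b i at the pole
  -- because W x is the identity.
  obtain ⟨-, b, -⟩ := exists_sections_basis (d := d) (F := F) (E := E) x
  have hU : ∀ᶠ y in 𝓝 x, y ∈ U := hL.isOpen.mem_nhds hx
  choose s hs using fun i ↦ exists_smooth_section_germ (s := fun y ↦ W y (b i)) (y := x) (by
    filter_upwards [hU] with y hy using hWs (b i) y hy)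
  obtain ⟨hlin, hframe⟩ := frame_near s x b fun i ↦ by
    rw [(hs i).self_of_nhds, hWx]
    rfl
  obtain ⟨D', hD'⟩ := exists_smooth_section_germ (s := D) (y := x) (by
    filter_upwards [hU] with y hy using hDs y hy)
  obtain ⟨a, ha'⟩ := hframe D'
  have ha : ∀ᶠ y in 𝓝 x, D y = ∑ i, a i y • (s i).1 y := by
    filter_upwards [ha', hD'] with y h1 h2
    rw [← h2, h1]
  -- The frame solves ρ W = 0, so its coefficient matrix is zero and the system decouples into
  -- scalar Euler equations t a' = -k a.
  have hN : ∀ i, ∀ᶠ y in 𝓝 x, (commutatorOp P f (s i)).1 y =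
      ∑ j, (0 : C^∞⟮𝓡 d, M; ℝ⟯) y • (s j).1 y := fun i ↦ by
    filter_upwards [hU, hf.eventually_nhds, (hs i).eventually_nhds] with y hy hfy hsy
    rw [← h.transport_eq hfy hsy, hW _ y hy]
    simp
  have hode := h.transport_radial hL hx ht₀ (s := s) (f := f) (a := a) (N := fun _ _ ↦ 0)
    (by rw [hpole]; exact hf) (by rw [hpole]; exact hlin) (by rw [hpole]; exact ha)
    (by rw [hpole]; exact hN) hD
  have hzero : ∀ j, ∀ᶠ t : ℝ in 𝓝 0, 0 ≤ t → a j (L.symm (t • ξ)) = 0 := fun j ↦ by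
    refine eventually_eq_zero_of_euler (k := k) (fun hk0 ↦ ?_) ?_
    · have h1 := ha.self_of_nhds
      rw [hk hk0] at h1
      rw [hpole]
      exact Fintype.linearIndependent_iff.1 hlin.self_of_nhds _ h1.symm j
    · filter_upwards [hode] with t ht
      obtain ⟨a', h1, h2⟩ := ht j
      refine ⟨h1.differentiableAt, ?_⟩
      rw [h1.deriv]
      simp only [ContMDiffMap.coe_zero, Pi.zero_apply, mul_zero, Finset.sum_const_zero,
        sub_zero] at h2
      linarith
  have hc := L.tendsto_symm_smul ht₀
  rw [hpole] at hc
  filter_upwards [eventually_all.2 hzero, hc.eventually ha] with t ht hat htpos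
  rw [hat]
  exact Finset.sum_eq_zero fun i _ ↦ by rw [ht i htpos, zero_smul]

/-- Uniqueness for the transport equation `(ρ - 2 k) D = 0`. -/
theorem IsInducedConnection.eq_zero_of_transport (h : IsInducedConnection g P nabla)
    (hL : g.IsExpInverse U x L) (hx : x ∈ U) {W : ∀ y, E x →L[ℂ] E y}
    (hWs : ∀ e, ∀ y ∈ U, ContMDiffAt (𝓡 d) ((𝓡 d).prod 𝓘(ℝ, F)) ∞
      (fun y ↦ TotalSpace.mk' F y (W y e)) y)
    (hWx : W x = ContinuousLinearMap.id ℂ (E x))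
    (hW : ∀ e, ∀ y ∈ U,
      transport g (fun y ↦ -g.inner x (L y) (L y)) nabla (fun y ↦ W y e) y = 0)
    {D : ∀ y, E y}
    (hDs : ∀ y ∈ U, ContMDiffAt (𝓡 d) ((𝓡 d).prod 𝓘(ℝ, F)) ∞
      (fun y ↦ TotalSpace.mk' F y (D y)) y) {k : ℕ}
    (hD : ∀ y ∈ U, transport g (fun y ↦ -g.inner x (L y) (L y)) nabla D y = (2 * k : ℝ) • D y)
    (hk : k = 0 → D x = 0) {y : M} (hy : y ∈ U) : D y = 0 := by
  have hξ : L y ∈ L.target := L.map_source (hL.source_eq ▸ hy)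
  set ξ := L y with hξdef
  have hseg : ∀ t ∈ Icc (0 : ℝ) 1, t • ξ ∈ L.target := fun t ht ↦
    hL.starConvex.smul_mem hξ ht.1 ht.2
  have hpole := h.eventually_eq_zero_at_pole hL hx ξ hWs hWx hW hDs hD hk
  have hclosed : IsClosed ({t : ℝ | D (L.symm (t • ξ)) = 0} ∩ Icc 0 1) := by
    rw [← isOpen_compl_iff, isOpen_iff_mem_nhds]
    intro t ht
    by_cases h01 : t ∈ Icc (0 : ℝ) 1
    · have hne : D (L.symm (t • ξ)) ≠ 0 := fun h0 ↦ ht ⟨h0, h01⟩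
      have := (L.tendsto_symm_smul (hseg t h01)).eventually
        (eventually_section_ne_zero (hDs _ (hL.symm_mem (hseg t h01))) hne)
      exact this.mono fun t' ht' hmem ↦ ht' hmem.1
    · filter_upwards [isClosed_Icc.isOpen_compl.mem_nhds h01] with t' ht' hmem
      exact ht' hmem.2
  -- Only right neighbourhoods are required, so at t = 0 the statement for t ≥ 0 suffices.
  have hall := hclosed.Icc_subset_of_forall_mem_nhdsWithin (hpole.self_of_nhds le_rfl) (by
    rintro t ⟨ht, h01⟩
    rcases h01.1.eq_or_lt with h0 | h0
    · subst h0
      filter_upwards [hpole.filter_mono nhdsWithin_le_nhds, self_mem_nhdsWithin] with t' h1 h2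
      exact h1 (le_of_lt h2)
    · exact (h.eventually_eq_zero_of_ne hL hx (hseg t ⟨h01.1, h01.2.le⟩) h0.ne' hDs hD
        ht).filter_mono nhdsWithin_le_nhds)
  have h1 : D (L.symm ((1 : ℝ) • ξ)) = 0 := hall (right_mem_Icc.2 zero_le_one)
  rwa [one_smul, hξdef, L.left_inv (hL.source_eq ▸ hy)] at h1

end TransportUniqueness


/-! ### Binomial algebra -/

/-- The binomial identity behind the transport equations of `P - z`. -/
theorem binomial_transport {X : Type*} [AddCommGroup X] [Module ℂ X] (v p : ℕ → X) (z : ℂ)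
    (n : ℕ) :
    ∑ m ∈ Finset.range (n + 2), (((n + 1).choose m : ℂ) * z ^ m) •
        ((2 * ((n + 1 - m : ℕ) : ℂ)) • (p (n + 1 - m - 1) + v (n + 1 - m))) -
      (2 * ((n + 1 : ℕ) : ℂ)) •
        ∑ m ∈ Finset.range (n + 2), (((n + 1).choose m : ℂ) * z ^ m) • v (n + 1 - m) =
    (2 * ((n + 1 : ℕ) : ℂ)) • (∑ m ∈ Finset.range (n + 1), ((n.choose m : ℂ) * z ^ m) • p (n - m) -
      z • ∑ m ∈ Finset.range (n + 1), ((n.choose m : ℂ) * z ^ m) • v (n - m)) := by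
  -- The term m = n + 1 carries the factor 0, so the truncated index of p there is harmless. The
  -- others match by (n+1-m) C(n+1,m) = (n+1) C(n,m).
  have hp : ∑ m ∈ Finset.range (n + 2), (((n + 1).choose m : ℂ) * z ^ m) •
      ((2 * ((n + 1 - m : ℕ) : ℂ)) • p (n + 1 - m - 1)) =
      (2 * ((n + 1 : ℕ) : ℂ)) •
        ∑ m ∈ Finset.range (n + 1), ((n.choose m : ℂ) * z ^ m) • p (n - m) := by
    rw [Finset.sum_range_succ, Finset.smul_sum]
    simp only [Nat.sub_self, Nat.cast_zero, mul_zero, zero_smul, smul_zero, add_zero]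
    refine Finset.sum_congr rfl fun m _ ↦ ?_
    have h1 : ((n.choose m : ℕ) : ℂ) * ((n + 1 : ℕ) : ℂ) =
        ((n + 1).choose m : ℂ) * ((n + 1 - m : ℕ) : ℂ) := by
      exact_mod_cast congrArg (Nat.cast (R := ℂ)) (Nat.choose_mul_succ_eq n m)
    have h2 : n + 1 - m - 1 = n - m := by omega
    rw [h2, smul_smul, smul_smul]
    congr 1
    linear_combination (-2 * z ^ m) * h1
  -- The net factor is 2(n+1-m) - 2(n+1) = -2m. The term m = 0 drops out, and shifting the index
  -- produces the factor z, with (m+1) C(n+1,m+1) = (n+1) C(n,m).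
  have hv : ∑ m ∈ Finset.range (n + 2), (((n + 1).choose m : ℂ) * z ^ m) •
      ((2 * ((n + 1 - m : ℕ) : ℂ)) • v (n + 1 - m)) - (2 * ((n + 1 : ℕ) : ℂ)) •
        ∑ m ∈ Finset.range (n + 2), (((n + 1).choose m : ℂ) * z ^ m) • v (n + 1 - m) =
      -((2 * ((n + 1 : ℕ) : ℂ)) •
        (z • ∑ m ∈ Finset.range (n + 1), ((n.choose m : ℂ) * z ^ m) • v (n - m))) := by
    rw [Finset.smul_sum, ← Finset.sum_sub_distrib, Finset.sum_range_succ', Finset.smul_sum,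
      Finset.smul_sum, ← Finset.sum_neg_distrib]
    simp only [Nat.sub_zero, smul_smul, Nat.add_sub_add_right]
    rw [mul_comm (2 * ((n + 1 : ℕ) : ℂ)) (((n + 1).choose 0 : ℂ) * z ^ 0), sub_self, add_zero]
    refine Finset.sum_congr rfl fun m hm ↦ ?_
    have h1 : ((n + 1 : ℕ) : ℂ) * (n.choose m : ℂ) =
        ((n + 1).choose (m + 1) : ℂ) * ((m + 1 : ℕ) : ℂ) := by
      exact_mod_cast congrArg (Nat.cast (R := ℂ)) (Nat.add_one_mul_choose_eq n m)
    have h2 : ((n - m : ℕ) : ℂ) = n - m :=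
      Nat.cast_sub (Nat.lt_succ_iff.1 (Finset.mem_range.1 hm))
    rw [← sub_smul, ← neg_smul, h2]
    congr 1
    push_cast at h1 ⊢
    linear_combination (2 * z ^ (m + 1)) * h1
  simp only [smul_add, Finset.sum_add_distrib]
  rw [add_sub_assoc, hv, hp, smul_sub, sub_eq_add_neg]

/-! ### Hadamard coefficients: the family for P - z, and uniqueness -/

section Hadamard

variable {d : ℕ} {M : Type*} [TopologicalSpace M] [T2Space M]
  [ChartedSpace (EuclideanSpace ℝ (Fin d)) M] [IsManifold (𝓡 d) ∞ M]
  {g : LorentzMetric d M}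
  {F : Type*} [NormedAddCommGroup F] [NormedSpace ℂ F]
  {E : M → Type*} [TopologicalSpace (TotalSpace F E)]
  [∀ x, AddCommGroup (E x)] [∀ x, Module ℂ (E x)] [∀ x, TopologicalSpace (E x)]
  [∀ x, IsTopologicalAddGroup (E x)] [∀ x, ContinuousSMul ℂ (E x)]
  [FiberBundle F E] [VectorBundle ℂ F E] [VectorBundle ℝ F E]
  {P : Module.End ℂ (SmoothSections d F E)} {nabla : CovariantDerivative (𝓡 d) F E}
  {U : Set M}

/-- With x frozen, the trivialized section is the coordinate matrix of V evaluated at the fixed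
coordinate vector of e, since trivializing E_x and back cancels. -/
theorem BiSection.IsSmoothOn.contMDiffAt_apply {V : BiSection E}
    (hV : BiSection.IsSmoothOn (d := d) (F := F) V U) {x y : M} (hx : x ∈ U) (hy : y ∈ U)
    (e : E x) : ContMDiffAt (𝓡 d) ((𝓡 d).prod 𝓘(ℝ, F)) ∞
      (fun y ↦ TotalSpace.mk' F y (V y x e)) y := by
  rw [contMDiffAt_section]
  have hxb := mem_baseSet_trivializationAt F E x
  have hyb := mem_baseSet_trivializationAt F E y
  set τ := trivializationAt F E y with hτ
  have h1 : ContMDiffAt (𝓡 d) 𝓘(ℝ, F →L[ℂ] F) ∞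
      (fun y' ↦ ContinuousLinearMap.inCoordinates F E F E x x y y' (V y' x)) y :=
    (hV y hy x hx).comp y (contMDiffAt_id.prodMk contMDiffAt_const)
  let ev : (F →L[ℂ] F) →L[ℝ] F := (ContinuousLinearMap.apply ℂ F
    (trivializationAt F E x ⟨x, e⟩).2).restrictScalars ℝ
  refine (ev.contDiff.contDiffAt.contMDiffAt.comp y h1).congr_of_eventuallyEq ?_
  filter_upwards [τ.open_baseSet.mem_nhds hyb] with y' hy'
  change _ = ContinuousLinearMap.inCoordinates F E F E x x y y' (V y' x) _
  rw [ContinuousLinearMap.inCoordinates_eq hxb hy']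
  change _ = τ.continuousLinearEquivAt ℂ y' hy' (V y' x
    (((trivializationAt F E x).continuousLinearEquivAt ℂ x hxb).symm
      ((trivializationAt F E x).continuousLinearEquivAt ℂ x hxb e)))
  rw [ContinuousLinearEquiv.symm_apply_apply]
  rfl

theorem BiSection.IsSmoothOn.eventually_contMDiffAt {V : BiSection E} (hU : IsOpen U)
    (hV : BiSection.IsSmoothOn (d := d) (F := F) V U) {x y : M} (hx : x ∈ U) (hy : y ∈ U)
    (e : E x) : ∀ᶠ y in 𝓝 y, ContMDiffAt (𝓡 d) ((𝓡 d).prod 𝓘(ℝ, F)) ∞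
      (fun y ↦ TotalSpace.mk' F y (V y x e)) y := by
  filter_upwards [hU.mem_nhds hy] with y hy using hV.contMDiffAt_apply hx hy e

theorem BiSection.IsSmoothOn.sum_smul {ι : Type*} {I : Finset ι} {c : ι → ℂ}
    {V : ι → BiSection E} (hV : ∀ i ∈ I, BiSection.IsSmoothOn (d := d) (F := F) (V i) U) :
    BiSection.IsSmoothOn (d := d) (F := F) (fun y x ↦ ∑ i ∈ I, c i • V i y x) U := by
  intro y₀ hy₀ x₀ hx₀
  have h1 : ∀ i ∈ I, ContMDiffAt ((𝓡 d).prod (𝓡 d)) 𝓘(ℝ, F →L[ℂ] F) ∞ (fun q : M × M ↦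
      c i • ContinuousLinearMap.inCoordinates F E F E x₀ q.2 y₀ q.1 (V i q.1 q.2)) (y₀, x₀) :=
    fun i hi ↦ (contDiff_const_smul (𝕜 := ℝ) (c i)).contDiffAt.contMDiffAt.comp
      (y₀, x₀) (hV i hi y₀ hy₀ x₀ hx₀)
  refine (ContMDiffAt.sum h1).congr_of_eventuallyEq (Eventually.of_forall fun q ↦ ?_)
  simp [ContinuousLinearMap.inCoordinates, ContinuousLinearMap.finsetSum_comp,
    ContinuousLinearMap.comp_finsetSum]

theorem rho_eq_transport (V : BiSection E) (y x : M) (e : E x) :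
    rho g U nabla V y x e = transport g (fun y ↦ g.Gam U y x) nabla (fun y ↦ V y x e) y := rfl

theorem LorentzMetric.exists_gam_germ {x y : M} (hconv : g.IsGeodesicallyConvex U) (hx : x ∈ U)
    (hy : y ∈ U) : ∃ f : C^∞⟮𝓡 d, M; ℝ⟯, ∀ᶠ y in 𝓝 y, f y = g.Gam U y x := by
  obtain ⟨L, hL, hGam⟩ := exists_isExpInverse_gam (hconv x hx)
  obtain ⟨f, hf⟩ := hL.exists_germ hy
  exact ⟨f, hf.mono fun y hy ↦ hy.trans (congrFun hGam y).symm⟩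

/-- Subtracting a constant from `P` does not change the induced connection. -/
theorem IsInducedConnection.sub_const (h : IsInducedConnection g P nabla) (z : ℂ) :
    IsInducedConnection g (P - z • (1 : Module.End ℂ (SmoothSections d F E))) nabla := by
  refine ⟨h.1, fun f s y ↦ ?_⟩
  have h1 : ∀ t : SmoothSections d F E,
      ((P - z • (1 : Module.End ℂ (SmoothSections d F E))) t).1 y = (P t).1 y - z • t.1 y :=
    fun t ↦ rfl
  rw [h1, h1, h.2, mulFun_apply, smul_sub, smul_comm z]
  abel

/-- Complex linearity is inherited from `commutatorOp`; the connection itself is only given as a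
real one. -/
theorem IsInducedConnection.transport_sum (h : IsInducedConnection g P nabla) {φ : M → ℝ}
    {f : C^∞⟮𝓡 d, M; ℝ⟯} {y : M} (hf : ∀ᶠ x in 𝓝 y, f x = φ x) {ι : Type*} {I : Finset ι}
    {c : ι → ℂ} {s : ι → ∀ x, E x}
    (hs : ∀ i, ∀ᶠ y in 𝓝 y, ContMDiffAt (𝓡 d) ((𝓡 d).prod 𝓘(ℝ, F)) ∞
      (fun y ↦ TotalSpace.mk' F y (s i y)) y) :
    transport g φ nabla (fun y ↦ ∑ i ∈ I, c i • s i y) y =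
      ∑ i ∈ I, c i • transport g φ nabla (s i) y := by
  choose t ht using fun i ↦ exists_smooth_section_germ (hs i)
  have h1 : ∀ᶠ x in 𝓝 y, (∑ i ∈ I, c i • t i).1 x = ∑ i ∈ I, c i • s i x := by
    filter_upwards [(eventually_all_finset I).2 fun i _ ↦ ht i] with x hx
    rw [coe_sum_apply]
    exact Finset.sum_congr rfl fun i hi ↦ congrArg (c i • ·) (hx i hi)
  rw [h.transport_eq hf h1, map_sum, coe_sum_apply]
  refine Finset.sum_congr rfl fun i _ ↦ ?_
  rw [h.transport_eq hf (ht i), map_smul]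
  rfl

theorem IsInducedConnection.applyLocal_sub_const_sum (h : IsInducedConnection g P nabla) (z : ℂ)
    {y : M} {ι : Type*} {I : Finset ι} {c : ι → ℂ} {s : ι → ∀ x, E x}
    (hs : ∀ i, ∀ᶠ y in 𝓝 y, ContMDiffAt (𝓡 d) ((𝓡 d).prod 𝓘(ℝ, F)) ∞
      (fun y ↦ TotalSpace.mk' F y (s i y)) y) :
    applyLocal (P - z • (1 : Module.End ℂ (SmoothSections d F E)))
        (fun y ↦ ∑ i ∈ I, c i • s i y) y =
      ∑ i ∈ I, c i • applyLocal P (s i) y - z • ∑ i ∈ I, c i • s i y := by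
  choose t ht using fun i ↦ exists_smooth_section_germ (hs i)
  have h1 : ∀ᶠ x in 𝓝 y, (∑ i ∈ I, c i • t i).1 x = ∑ i ∈ I, c i • s i x := by
    filter_upwards [(eventually_all_finset I).2 fun i _ ↦ ht i] with x hx
    rw [coe_sum_apply]
    exact Finset.sum_congr rfl fun i hi ↦ congrArg (c i • ·) (hx i hi)
  rw [(h.sub_const z).applyLocal_eq h1]
  change (P (∑ i ∈ I, c i • t i)).1 y - z • (∑ i ∈ I, c i • t i).1 y = _
  rw [h1.self_of_nhds, map_sum, coe_sum_apply]
  congr 1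
  refine Finset.sum_congr rfl fun i _ ↦ ?_
  rw [h.applyLocal_eq (ht i), map_smul]
  rfl

/-- The Hadamard coefficients of `P - z` in terms of those of `P`. -/
theorem IsHadamardFamily.sub_const (hU : IsOpen U) (hconv : g.IsGeodesicallyConvex U)
    {V : ℕ → BiSection E} (hV : IsHadamardFamily g U P V) (z : ℂ) :
    IsHadamardFamily g U (P - z • (1 : Module.End ℂ (SmoothSections d F E)))
      (fun k y x ↦ ∑ m ∈ Finset.range (k + 1),
        ((k.choose m : ℂ) * z ^ m) • V (k - m) y x) := by
  obtain ⟨hs, ⟨nabla, hn, h0, hk⟩, hid⟩ := hV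
  refine ⟨fun k ↦ BiSection.IsSmoothOn.sum_smul fun m _ ↦ hs (k - m), ⟨nabla, hn.sub_const z, ?_, ?_⟩,
    fun x hx ↦ by simpa using hid x hx⟩
  · intro y hy x hx e
    simpa using h0 y hy x hx e
  · intro k hk1 y hy x hx e
    obtain ⟨n, rfl⟩ : ∃ n, k = n + 1 := ⟨k - 1, by omega⟩
    obtain ⟨f, hf⟩ := LorentzMetric.exists_gam_germ hconv hx hy
    -- The index j = 0 is included: there the truncated `V (0 - 1)` is multiplied by 0.
    have hr : ∀ j, rho g U nabla (V j) y x e = (2 * (j : ℂ)) •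
        (applyLocal P (fun y' ↦ V (j - 1) y' x e) y + V j y x e) := by
      intro j
      rcases Nat.eq_zero_or_pos j with rfl | hj
      · rw [h0 y hy x hx e]
        simp
      · rw [smul_add, ← hk j hj y hy x hx e, sub_add_cancel]
    have happ : ∀ (k : ℕ) y, (∑ m ∈ Finset.range (k + 1),
        ((k.choose m : ℂ) * z ^ m) • V (k - m) y x) e =
        ∑ m ∈ Finset.range (k + 1), ((k.choose m : ℂ) * z ^ m) • V (k - m) y x e := by
      intro k y
      simp
    rw [rho_eq_transport]
    simp only [happ, Nat.add_sub_cancel]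
    rw [hn.transport_sum hf (s := fun m y ↦ V (n + 1 - m) y x e)
        (fun m ↦ (hs (n + 1 - m)).eventually_contMDiffAt hU hx hy e),
      hn.applyLocal_sub_const_sum z (s := fun m y ↦ V (n - m) y x e)
        (fun m ↦ (hs (n - m)).eventually_contMDiffAt hU hx hy e)]
    simp only [← rho_eq_transport, hr]
    exact binomial_transport (fun j ↦ V j y x e)
      (fun j ↦ applyLocal P (fun y' ↦ V j y' x e) y) z n

variable [ContMDiffVectorBundle ∞ F E (𝓡 d)] [FiniteDimensional ℂ F]

/-- Hadamard coefficients are unique. -/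
theorem IsHadamardFamily.unique (hU : IsOpen U) (hconv : g.IsGeodesicallyConvex U)
    {V V' : ℕ → BiSection E} (hV : IsHadamardFamily g U P V) (hV' : IsHadamardFamily g U P V')
    (k : ℕ) : ∀ y ∈ U, ∀ x ∈ U, V k y x = V' k y x := by
  obtain ⟨hs, ⟨nabla, hn, h0, hk⟩, hid⟩ := hV
  obtain ⟨hs', ⟨nabla', hn', h0', hk'⟩, hid'⟩ := hV'
  -- The two families may come with different connection witnesses, so the equation for the
  -- difference is phrased with both; `transport_eq` turns each into the same commutator of `P`.
  have hzero : ∀ k, (∀ y ∈ U, ∀ x ∈ U, ∀ e : E x,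
      rho g U nabla (V k) y x e - rho g U nabla' (V' k) y x e =
        (2 * k : ℝ) • (V k y x e - V' k y x e)) → (k = 0 → ∀ x ∈ U, V k x x = V' k x x) →
      ∀ y ∈ U, ∀ x ∈ U, V k y x = V' k y x := by
    intro k hrho hk0 y hy x hx
    ext e
    obtain ⟨L, hL, hGam⟩ := LorentzMetric.exists_isExpInverse_gam (hconv x hx)
    rw [← sub_eq_zero]
    refine hn.eq_zero_of_transport hL hx (W := fun y ↦ V 0 y x) (k := k)
      (D := fun y ↦ V k y x e - V' k y x e)
      (fun e y hy ↦ (hs 0).contMDiffAt_apply hx hy e) (hid x hx) ?_ ?_ ?_ ?_ hy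
    · intro e y hy
      rw [← hGam]
      exact h0 y hy x hx e
    · intro y hy
      exact ContMDiffAt.sub_section ((hs k).contMDiffAt_apply hx hy e)
        ((hs' k).contMDiffAt_apply hx hy e)
    · intro y hy
      obtain ⟨f, hf⟩ := LorentzMetric.exists_gam_germ hconv hx hy
      obtain ⟨t, ht⟩ := exists_smooth_section_germ ((hs k).eventually_contMDiffAt hU hx hy e)
      obtain ⟨t', ht'⟩ := exists_smooth_section_germ ((hs' k).eventually_contMDiffAt hU hx hy e)
      have htt : ∀ᶠ y in 𝓝 y, (t - t').1 y = V k y x e - V' k y x e := by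
        filter_upwards [ht, ht'] with y h1 h2
        rw [← h1, ← h2]
        rfl
      rw [← hGam, hn.transport_eq hf htt, ← hrho y hy x hx e, rho_eq_transport, rho_eq_transport,
        hn.transport_eq hf ht, hn'.transport_eq hf ht', map_sub]
      rfl
    · intro h
      rw [hk0 h x hx, sub_self]
  induction k with
  | zero =>
    refine hzero 0 (fun y hy x hx e ↦ ?_) fun _ x hx ↦ by rw [hid x hx, hid' x hx]
    rw [h0 y hy x hx e, h0' y hy x hx e]
    simp
  | succ n ih =>
    refine hzero (n + 1) (fun y hy x hx e ↦ ?_) (by simp)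
    have h1 := hk (n + 1) (by omega) y hy x hx e
    have h2 := hk' (n + 1) (by omega) y hy x hx e
    simp only [Nat.add_sub_cancel] at h1 h2
    obtain ⟨t, ht⟩ := exists_smooth_section_germ ((hs n).eventually_contMDiffAt hU hx hy e)
    -- U is open, so equality on U at level n is equality of germs: one extension t serves both
    -- families, and the right-hand sides at level n + 1 agree.
    have ht' : ∀ᶠ y in 𝓝 y, t.1 y = V' n y x e := by
      filter_upwards [ht, hU.mem_nhds hy] with y' h3 h4
      rw [h3, ih y' h4 x hx]
    rw [hn.applyLocal_eq ht] at h1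
    rw [hn.applyLocal_eq ht', ← h1] at h2
    rw [← Complex.coe_smul, smul_sub, sub_eq_sub_iff_sub_eq_sub]
    push_cast at h2 ⊢
    exact h2.symm

end Hadamard

end

theorem proposition4p2 {d : ℕ} {M : Type*} [TopologicalSpace M] [T2Space M]
    [SecondCountableTopology M] [ChartedSpace (EuclideanSpace ℝ (Fin d)) M]
    [IsManifold (𝓡 d) ∞ M] (g : LorentzMetric d M)
    {F : Type*} [NormedAddCommGroup F] [NormedSpace ℂ F] [FiniteDimensional ℂ F]
    {E : M → Type*} [TopologicalSpace (TotalSpace F E)]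
    [∀ x, AddCommGroup (E x)] [∀ x, Module ℂ (E x)] [∀ x, TopologicalSpace (E x)]
    [∀ x, IsTopologicalAddGroup (E x)] [∀ x, ContinuousSMul ℂ (E x)]
    [FiberBundle F E] [VectorBundle ℂ F E] [VectorBundle ℝ F E]
    [ContMDiffVectorBundle ∞ F E (𝓡 d)]
    (P : Module.End ℂ (SmoothSections d F E)) (hP : IsNormallyHyperbolic g P)
    (U : Set M) (hU : IsOpen U) (hconv : g.IsGeodesicallyConvex U)
    (V : ℕ → BiSection E) (hV : IsHadamardFamily g U P V) (z : ℂ) :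
    IsHadamardFamily g U (P - z • (1 : Module.End ℂ (SmoothSections d F E)))
      (fun k y x ↦ ∑ m ∈ Finset.range (k + 1), ((k.choose m : ℂ) * z ^ m) • V (k - m) y x) ∧
    ∀ Vz : ℕ → BiSection E,
      IsHadamardFamily g U (P - z • (1 : Module.End ℂ (SmoothSections d F E))) Vz →
      ∀ k : ℕ, ∀ y ∈ U, ∀ x ∈ U,
        Vz k y x = ∑ m ∈ Finset.range (k + 1), ((k.choose m : ℂ) * z ^ m) • V (k - m) y x :=
  ⟨hV.sub_const hU hconv z, fun _ hVz ↦ hVz.unique hU hconv (hV.sub_const hU hconv z)⟩
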